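/- Let $\Omega\subset\mathbb C^n$ be a simply connected domain and let $a^k_{ij}:\Omega\to\mathbb C$ ($i,j,k=1,\dots,n$) be holomorphic functions. For $z\in\Omega$ let $A(z)$ be the bilinear operator on $\mathbb C^n$ for which $A(z)(v,\cdot)$ is the matrix with entry $\sum_{j=1}^n a^k_{ij}(z)v_j$ in row $k$ and column $i$. For a locally biholomorphic mapping $f:\Omega\to\mathbb C^n$ put $P_f(z)=[Df(z)]^{-1}D^2f(z)(\cdot,\cdot)$. Let $e_1,\dots,e_n$ be the standard basis of $\mathbb C^n$ and put $$P^k_{ij}=a^k_{ij}-\frac1{n+1}\Bigl(\delta^k_i\,\mathrm{tr}\,A(z)(e_j,\cdot)+\delta^k_j\,\mathrm{tr}\,A(z)(e_i,\cdot)\Bigr).$$ Then there exists a locally biholomorphic $f:\Omega\to\mathbb C^n$ with $P_f=A$ on $\Omega$ if and only if the following conditions hold: (i) $a^k_{ij}=a^k_{ji}$ on $\Omega$ for all $i,j,k$; (ii) there is a holomorphic function $\varphi:\Omega\to\mathbb C$ with $\sum_{k=1}^n a^k_{kj}=\partial\varphi/\partial z_j$ on $\Omega$ for all $j$; (iii)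 for this $\varphi$, there are holomorphic functions $P^0_{ij}:\Omega\to\mathbb C$ such that the system $$\frac{\partial^2u}{\partial z_i\partial z_j}=\sum_{k=1}^nP^k_{ij}\frac{\partial u}{\partial z_k}+P^0_{ij}u,\qquad i,j=1,\dots,n,$$ is integrable and has $u=\exp\bigl(-\varphi/(n+1)\bigr)$ as a solution on $\Omega$. Here integrable means that $P^k_{ij}=P^k_{ji}$, $P^0_{ij}=P^0_{ji}$ and, for all $i,j,l,m$, $$\frac{\partial P^m_{ij}}{\partial z_l}+\sum_kP^k_{ij}P^m_{kl}+\delta^m_lP^0_{ij}=\frac{\partial P^m_{il}}{\partial z_j}+\sum_kP^k_{il}P^m_{kj}+\delta^m_jP^0_{il},$$ $$\frac{\partial P^0_{ij}}{\partial z_l}+\sum_kP^k_{ij}P^0_{kl}=\frac{\partial P^0_{il}}{\partial z_j}+\sum_kP^k_{il}P^0_{kj}.$$ (For $n\ge2$ these conditions determine $P^0_{ij}$ from the $P^k_{ij}$: $(n-1)P^0_{ij}=\sum_{k,l}P^k_{il}P^l_{kj}-\sum_l\partial P^l_{ij}/\partial z_l$.) -/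

import Mathlib

open scoped BigOperators

noncomputable section

/-- The partial derivative `∂g/∂z_i` of a function on `ℂⁿ`. -/
def partialDeriv {n : ℕ} (i : Fin n) (g : (Fin n → ℂ) → ℂ) (z : Fin n → ℂ) : ℂ :=
  fderiv ℂ g z (Pi.single i 1)

/-- `f` is locally biholomorphic on `Ω`: near every point of `Ω` it is a homeomorphism between
open sets that is holomorphic together with its inverse. -/
def IsLocallyBiholomorphicOn {n : ℕ} (f : (Fin n → ℂ) → (Fin n → ℂ)) (Ω : Set (Fin n → ℂ)) :
    Prop :=
  ∀ z ∈ Ω, ∃ e : OpenPartialHomeomorph (Fin n → ℂ) (Fin n → ℂ),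
    z ∈ e.source ∧ e.source ⊆ Ω ∧ Set.EqOn f e e.source ∧
      DifferentiableOn ℂ e e.source ∧ DifferentiableOn ℂ e.symm e.target

/-- The preSchwarzian `P_f(z)(v, w) = [Df(z)]⁻¹ D²f(z)(v, w)`. The inverse is the true inverse
wherever `Df(z)` is invertible, in particular wherever `f` is locally biholomorphic. -/
def preSchwarzian {n : ℕ} (f : (Fin n → ℂ) → (Fin n → ℂ)) (z v w : Fin n → ℂ) : Fin n → ℂ :=
  (fderiv ℂ f z).inverse (fderiv ℂ (fderiv ℂ f) z v w)

/-- The matrix of the linear map `A(z)(v, ·)`. Its entry in row `k` and column `i` is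
`∑ j, a^k_{ij}(z) v_j`, where `a k i j` stands for `a^k_{ij}`. -/
def opMatrix {n : ℕ} (a : Fin n → Fin n → Fin n → (Fin n → ℂ) → ℂ) (z v : Fin n → ℂ) :
    Matrix (Fin n) (Fin n) ℂ :=
  Matrix.of fun k i => ∑ j, a k i j z * v j

/-- The trace-free part of `A`: the coefficients
`P^k_{ij} = a^k_{ij} - (δ^k_i tr A(z)(e_j, ·) + δ^k_j tr A(z)(e_i, ·)) / (n + 1)`,
written `traceFreePart a k i j`. -/
def traceFreePart {n : ℕ} (a : Fin n → Fin n → Fin n → (Fin n → ℂ) → ℂ)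
    (k i j : Fin n) (z : Fin n → ℂ) : ℂ :=
  a k i j z - 1 / ((n : ℂ) + 1) *
    ((if k = i then 1 else 0) * (opMatrix a z (Pi.single j 1)).trace +
      (if k = j then 1 else 0) * (opMatrix a z (Pi.single i 1)).trace)

/-- `u` is a holomorphic solution on `Ω` of the linear system
`∂²u/∂z_i∂z_j = ∑ k, P^k_{ij} ∂u/∂z_k + P⁰_{ij} u` for all `i`, `j`. -/
def IsSystemSolution {n : ℕ} (P : Fin n → Fin n → Fin n → (Fin n → ℂ) → ℂ)
    (P0 : Fin n → Fin n → (Fin n → ℂ) → ℂ) (Ω : Set (Fin n → ℂ)) (u : (Fin n → ℂ) → ℂ) : Prop :=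
  DifferentiableOn ℂ u Ω ∧ ∀ z ∈ Ω, ∀ i j,
    partialDeriv i (partialDeriv j u) z =
      ∑ k, P k i j z * partialDeriv k u z + P0 i j z * u z

/-- The integrability conditions on `Ω` of the system
`∂²u/∂z_i∂z_j = ∑ k, P^k_{ij} ∂u/∂z_k + P⁰_{ij} u`: both sides are symmetric in `i, j`, and in
`∂/∂z_l (∂²u/∂z_i∂z_j) = ∂/∂z_j (∂²u/∂z_i∂z_l)`, after the second derivatives of `u` have been
eliminated by means of the system, the coefficients of every `∂u/∂z_m` and of `u` agree.
If `n ≥ 2` and `∑ j, P^j_{ij} = 0`, summing `deriv_coeff` over `m = l` shows that these conditions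
determine `P⁰` from `P`:
`(n - 1) P⁰_{ij} = ∑ k, ∑ l, P^k_{il} P^l_{kj} - ∑ l, ∂P^l_{ij}/∂z_l`. -/
structure IsIntegrableSystem {n : ℕ} (P : Fin n → Fin n → Fin n → (Fin n → ℂ) → ℂ)
    (P0 : Fin n → Fin n → (Fin n → ℂ) → ℂ) (Ω : Set (Fin n → ℂ)) : Prop where
  symm : ∀ z ∈ Ω, ∀ k i j, P k i j z = P k j i z
  symm_zero : ∀ z ∈ Ω, ∀ i j, P0 i j z = P0 j i z
  deriv_coeff : ∀ z ∈ Ω, ∀ i j l m,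
    partialDeriv l (P m i j) z + ∑ k, P k i j z * P m k l z + (if m = l then P0 i j z else 0) =
      partialDeriv j (P m i l) z + ∑ k, P k i l z * P m k j z + (if m = j then P0 i l z else 0)
  zero_coeff : ∀ z ∈ Ω, ∀ i j l,
    partialDeriv l (P0 i j) z + ∑ k, P k i j z * P0 k l z =
      partialDeriv j (P0 i l) z + ∑ k, P k i l z * P0 k j z

end

/-!
Write `A` as a connection `1`-form on `Ω` with values in the endomorphisms of `ℂⁿ`. The equation
`P_f = A` says that `M = Df` satisfies `dM = M A`, that is, `Df` is an invertible parallel section.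
Such an `M` can exist only if the connection is flat, and it is a differential `Df` only if `A` is
symmetric. Conversely, on a simply connected domain a flat connection has a global invertible
parallel section `M`; symmetry of `A` makes the rows of `M` closed, so `M = Df`, and `f` is locally
biholomorphic by the inverse function theorem (`exists_preSchwarzian_eq_iff`).

So it remains to see that, for symmetric `A`, conditions (ii) and (iii) say that `A` is flat.
Put `s_j = tr A(e_j, ·) / (n + 1)`. By (ii), `u = exp (-φ / (n + 1))` satisfies `∂_j u = -s_j u`, so
it solves the system exactly when `P⁰_{ij} = ∑ k, P^k_{ij} s_k + s_i s_j - ∂_i s_j`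
(`isSystemSolution_exp_potential_iff`). With this `P⁰`, the first family of integrability conditions
is the vanishing of the curvature of `A`, rewritten in terms of its trace-free part and its trace
(`deriv_coeff_iff_isFlatConnectionOn`), and the second family follows from the first
(`zero_coeff_of_deriv_coeff`). If `A` is flat, the trace of its curvature vanishes too, so `s` is
closed and has a potential, which gives (ii).

The analytic input is developed first: derivatives of holomorphic functions of several variables are
holomorphic (`differentiableOn_fderiv_complex`); a flat connection has local parallel sections,
obtained by Picard iteration along rays and extended to all directions by flatness
(`IsFlatConnectionOn.exists_isParallelAt`); local sections, and local primitives of closed forms,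
are glued over a simply connected space by lifting to a covering space
(`exists_global_of_locally_const_transition`).
-/

section

open Metric Set Filter Topology

/-! ### Holomorphic functions of several variables -/

/-- Cauchy's estimate for the Fréchet derivative. -/
theorem norm_fderiv_le_of_forall_mem_closedBall {E F : Type*} [NormedAddCommGroup E]
    [NormedSpace ℂ E] [NormedAddCommGroup F] [NormedSpace ℂ F] {f : E → F} {U : Set E}
    (hU : IsOpen U) (hf : DifferentiableOn ℂ f U) {z : E} {r C : ℝ} (hr : 0 < r)
    (hz : closedBall z r ⊆ U) (hC : ∀ w ∈ closedBall z r, ‖f w‖ ≤ C) :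
    ‖fderiv ℂ f z‖ ≤ C / r := by
  have hC0 : 0 ≤ C := (norm_nonneg _).trans (hC z (mem_closedBall_self hr.le))
  refine ContinuousLinearMap.opNorm_le_of_unit_norm (by positivity) fun v hv => ?_
  have hmem : ∀ ζ ∈ closedBall (0 : ℂ) r, z + ζ • v ∈ closedBall z r := by
    intro ζ hζ
    simpa [norm_smul, hv] using hζ
  have hline : ∀ ζ : ℂ, HasDerivAt (fun ζ : ℂ => z + ζ • v) v ζ := fun ζ => by
    simpa using ((hasDerivAt_id ζ).smul_const v).const_add z
  have hd : ∀ ζ ∈ closedBall (0 : ℂ) r,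
      HasDerivAt (fun ζ : ℂ => f (z + ζ • v)) (fderiv ℂ f (z + ζ • v) v) ζ := fun ζ hζ =>
    (hf.differentiableAt (hU.mem_nhds (hz (hmem ζ hζ)))).hasFDerivAt.comp_hasDerivAt ζ (hline ζ)
  have h0 := (hd 0 (mem_closedBall_self hr.le)).deriv
  simp only [zero_smul, add_zero] at h0
  rw [← h0]
  refine Complex.norm_deriv_le_of_forall_mem_sphere_norm_le hr
    (DifferentiableOn.diffContOnCl_ball (U := closedBall 0 r) ?_ subset_rfl) ?_
  · exact fun ζ hζ => (hd ζ hζ).differentiableAt.differentiableWithinAt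
  · exact fun ζ hζ => hC _ (hmem ζ (sphere_subset_closedBall hζ))

theorem differentiableAt_clm_of_forall_apply {E F G : Type*} [NormedAddCommGroup E]
    [NormedSpace ℂ E] [FiniteDimensional ℂ E] [NormedAddCommGroup F] [NormedSpace ℂ F]
    [NormedAddCommGroup G] [NormedSpace ℂ G] {f : G → E →L[ℂ] F} {z : G}
    (h : ∀ v, DifferentiableAt ℂ (fun x => f x v) z) : DifferentiableAt ℂ f z := by
  let e₁ : E ≃L[ℂ] (Fin (Module.finrank ℂ E) → ℂ) :=
    ContinuousLinearEquiv.ofFinrankEq (Module.finrank_fin_fun ℂ).symm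
  let e₂ := (e₁.arrowCongr (1 : F ≃L[ℂ] F)).trans
    (ContinuousLinearEquiv.piRing (Fin (Module.finrank ℂ E)))
  have : DifferentiableAt ℂ (fun x => e₂ (f x)) z :=
    differentiableAt_pi.2 fun i => h _
  exact e₂.comp_differentiableAt_iff.1 this

/-- The derivative of a holomorphic function of several variables is holomorphic: directional
derivatives are given by Cauchy integrals over circles in complex lines, and these depend
holomorphically on the base point. -/
theorem differentiableOn_fderiv_complex {E F : Type*} [NormedAddCommGroup E]
    [NormedSpace ℂ E] [FiniteDimensional ℂ E] [NormedAddCommGroup F] [NormedSpace ℂ F]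
    [FiniteDimensional ℂ F] {f : E → F} {U : Set E} (hf : DifferentiableOn ℂ f U)
    (hU : IsOpen U) : DifferentiableOn ℂ (fderiv ℂ f) U := by
  intro x₀ hx₀
  refine DifferentiableAt.differentiableWithinAt ?_
  have : CompleteSpace F := FiniteDimensional.complete ℂ F
  have : ProperSpace E := FiniteDimensional.proper ℂ E
  have : ProperSpace (E →L[ℂ] F) := FiniteDimensional.proper ℂ _
  have : SecondCountableTopology (E →L[ℂ] F) := inferInstance
  let _ : MeasurableSpace E := borel E
  have : BorelSpace E := ⟨rfl⟩
  obtain ⟨R, hR, hRU⟩ := nhds_basis_closedBall.mem_iff.1 (hU.mem_nhds hx₀)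
  obtain ⟨C, hC⟩ := (isCompact_closedBall x₀ R).exists_bound_of_continuousOn
    (hf.continuousOn.mono hRU)
  -- balls of radius `R / 3` about points at distance at most `2 R / 3` stay inside
  set r := R / 3 with hr
  have hr0 : 0 < r := by positivity
  have hsub : ∀ z ∈ ball x₀ r, ∀ v : E, ‖v‖ ≤ 1 → ∀ ζ : ℂ, ‖ζ‖ ≤ r →
      closedBall (z + ζ • v) r ⊆ closedBall x₀ R := by
    intro z hz v hv ζ hζ
    refine closedBall_subset_closedBall' ?_
    have h1 : dist (z + ζ • v) z ≤ r := by
      rw [dist_eq_norm, add_sub_cancel_left, norm_smul]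
      nlinarith [norm_nonneg ζ, norm_nonneg v]
    have h2 := dist_triangle (z + ζ • v) z x₀
    have h3 : dist z x₀ < r := hz
    linarith
  have hdiff : ∀ z ∈ ball x₀ r, ∀ v : E, ‖v‖ ≤ 1 → ∀ ζ : ℂ, ‖ζ‖ ≤ r →
      DifferentiableAt ℂ f (z + ζ • v) := fun z hz v hv ζ hζ =>
    hf.differentiableAt (hU.mem_nhds (hRU (hsub z hz v hv ζ hζ (mem_closedBall_self hr0.le))))
  have hline : ∀ (z v : E) (ζ : ℂ), HasDerivAt (fun ζ : ℂ => z + ζ • v) v ζ := fun z v ζ => by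
    simpa using ((hasDerivAt_id ζ).smul_const v).const_add z
  have hunit : ∀ v : E, ‖v‖ ≤ 1 → DifferentiableAt ℂ (fun x => fderiv ℂ f x v) x₀ := by
    intro v hv
    let k : ℝ → ℂ := fun θ =>
      deriv (circleMap 0 r) θ * ((circleMap 0 r θ - 0) ^ 2)⁻¹
    have hk : Continuous k := by
      have h1 : ∀ θ, (circleMap 0 r θ - 0) ^ 2 ≠ 0 := fun θ => by
        simp [hr0.ne']
      simp only [k, deriv_circleMap]
      exact ((continuous_circleMap 0 r).mul continuous_const).mul
        (Continuous.inv₀ (by fun_prop) h1)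
    have hnorm : ∀ θ, ‖circleMap 0 r θ‖ ≤ r := fun θ => by simp [abs_of_pos hr0]
    have hcauchy : ∀ z ∈ ball x₀ r, fderiv ℂ f z v = (2 * (Real.pi : ℂ) * Complex.I)⁻¹ •
        ∫ θ in (0 : ℝ)..2 * Real.pi, k θ • f (z + circleMap 0 r θ • v) := by
      intro z hz
      have hV : IsOpen ((fun ζ : ℂ => z + ζ • v) ⁻¹' U) := hU.preimage (by fun_prop)
      have hsubV : closedBall (0 : ℂ) r ⊆ (fun ζ : ℂ => z + ζ • v) ⁻¹' U := fun ζ hζ =>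
        hRU (hsub z hz v hv ζ (by simpa using hζ) (mem_closedBall_self hr0.le))
      have h := Complex.two_pi_I_inv_smul_circleIntegral_sub_sq_inv_smul_of_differentiable hV
        hsubV (hf.comp (fun ζ _ => (hline z v ζ).differentiableAt.differentiableWithinAt)
          (fun ζ hζ => hζ)) (mem_ball_self hr0)
      have hd := ((hdiff z hz v hv 0 (by simpa using hr0.le)).hasFDerivAt.comp_hasDerivAt 0
        (hline z v 0)).deriv
      simp only [zero_smul, add_zero] at hd
      rw [← hd, ← h, circleIntegral]
      simp only [k, mul_smul, Function.comp_apply]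
    have hev : (fun x => fderiv ℂ f x v) =ᶠ[𝓝 x₀] fun z => (2 * (Real.pi : ℂ) * Complex.I)⁻¹ •
        ∫ θ in (0 : ℝ)..2 * Real.pi, k θ • f (z + circleMap 0 r θ • v) :=
      Filter.eventually_of_mem (ball_mem_nhds x₀ hr0) hcauchy
    have hx₀r : x₀ ∈ ball x₀ r := mem_ball_self hr0
    have hcont : ∀ z ∈ ball x₀ r, Continuous fun θ : ℝ => k θ • f (z + circleMap 0 r θ • v) := by
      intro z hz
      refine hk.smul (continuous_iff_continuousAt.2 fun θ => ?_)
      exact (hdiff z hz v hv _ (hnorm θ)).continuousAt.comp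
        (f := fun θ : ℝ => z + circleMap 0 r θ • v)
        (Continuous.continuousAt (by fun_prop))
    obtain ⟨K, hK⟩ := (isCompact_Icc (a := (0 : ℝ)) (b := 2 * Real.pi)).exists_bound_of_continuousOn
      hk.continuousOn
    refine DifferentiableAt.congr_of_eventuallyEq ?_ hev
    refine DifferentiableAt.const_smul ?_ _
    refine (intervalIntegral.hasFDerivAt_integral_of_dominated_of_fderiv_le
      (F' := fun z θ => k θ • fderiv ℂ f (z + circleMap 0 r θ • v)) (bound := fun _ => K * (C / r))
      (ball_mem_nhds x₀ hr0) ?_ ?_ ?_ ?_ ?_ ?_).differentiableAt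
    · filter_upwards [ball_mem_nhds x₀ hr0] with z hz
      exact (hcont z hz).aestronglyMeasurable
    · exact (hcont x₀ hx₀r).intervalIntegrable _ _
    · have h1 : Measurable fun θ : ℝ => fderiv ℂ f (x₀ + circleMap 0 r θ • v) :=
        (measurable_fderiv ℂ f).comp (Continuous.measurable (by fun_prop))
      exact (hk.aestronglyMeasurable).smul h1.stronglyMeasurable.aestronglyMeasurable
    · refine Filter.Eventually.of_forall fun θ hθ z hz => ?_
      rw [uIoc_of_le (by positivity)] at hθ
      rw [norm_smul]
      refine mul_le_mul (hK θ ⟨hθ.1.le, hθ.2⟩) ?_ (norm_nonneg _)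
        ((norm_nonneg _).trans (hK θ ⟨hθ.1.le, hθ.2⟩))
      have hs := hsub z hz v hv _ (hnorm θ)
      exact norm_fderiv_le_of_forall_mem_closedBall hU hf hr0 (hs.trans hRU)
        fun w hw => hC w (hs hw)
    · simp
    · refine Filter.Eventually.of_forall fun θ _ z hz => ?_
      have h1 : HasFDerivAt (fun z : E => z + circleMap 0 r θ • v) (ContinuousLinearMap.id ℂ E) z :=
        (hasFDerivAt_id z).add_const _
      have h2 := (hdiff z hz v hv _ (hnorm θ)).hasFDerivAt.comp z h1
      rw [ContinuousLinearMap.comp_id] at h2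
      exact h2.const_smul (k θ)
  refine differentiableAt_clm_of_forall_apply fun v => ?_
  rcases eq_or_ne v 0 with rfl | hv
  · simp
  · have h := (hunit ((‖v‖⁻¹ : ℂ) • v) (by simp [norm_smul, hv])).const_smul (‖v‖ : ℂ)
    refine h.congr_of_eventuallyEq (Filter.Eventually.of_forall fun x => ?_)
    simp [hv]

/-! ### Radial primitives and series of holomorphic functions -/

theorem ofReal_smul_mem_ball {E : Type*} [NormedAddCommGroup E] [NormedSpace ℂ E] {z : E} {r : ℝ}
    (hz : z ∈ ball (0 : E) r) {t : ℝ} (ht : t ∈ Icc (0 : ℝ) 1) : (t : ℂ) • z ∈ ball (0 : E) r := by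
  rw [mem_ball_zero_iff] at hz ⊢
  rw [norm_smul, Complex.norm_real, Real.norm_eq_abs, abs_of_nonneg ht.1]
  nlinarith [norm_nonneg z, ht.2]

theorem hasDerivAt_ofReal_smul {E : Type*} [NormedAddCommGroup E] [NormedSpace ℂ E] (z : E)
    (t : ℝ) : HasDerivAt (fun t : ℝ => (t : ℂ) • z) z t := by
  simpa using Complex.ofRealCLM.hasDerivAt.smul_const z

/-- The integral of a holomorphic `1`-form along the segments from the origin is holomorphic, and
its radial derivative is the value of the form on the radial vector. -/
theorem hasFDerivAt_radial_integral {E F : Type*} [NormedAddCommGroup E] [NormedSpace ℂ E]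
    [FiniteDimensional ℂ E] [NormedAddCommGroup F] [NormedSpace ℂ F] [FiniteDimensional ℂ F]
    {ω : E → E →L[ℂ] F} {r : ℝ} (hω : DifferentiableOn ℂ ω (ball 0 r)) {z : E}
    (hz : z ∈ ball 0 r) :
    ∃ L : E →L[ℂ] F, HasFDerivAt (fun z : E => ∫ t in (0 : ℝ)..1, ω ((t : ℂ) • z) z) L z ∧
      L z = ω z z := by
  have : CompleteSpace F := FiniteDimensional.complete ℂ F
  have : ProperSpace E := FiniteDimensional.proper ℂ E
  have hdω := differentiableOn_fderiv_complex hω isOpen_ball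
  set ω' : E → ℝ → E →L[ℂ] F := fun z t =>
    ω ((t : ℂ) • z) + (t : ℂ) • (fderiv ℂ ω ((t : ℂ) • z)).flip z with hω'
  have hsmul : ∀ z ∈ ball (0 : E) r, ∀ t ∈ Icc (0 : ℝ) 1,
      HasFDerivAt ω (fderiv ℂ ω ((t : ℂ) • z)) ((t : ℂ) • z) := fun z hz t ht =>
    (hω.differentiableAt (isOpen_ball.mem_nhds (ofReal_smul_mem_ball hz ht))).hasFDerivAt
  have hdiff : ∀ z ∈ ball (0 : E) r, ∀ t ∈ Icc (0 : ℝ) 1,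
      HasFDerivAt (fun z : E => ω ((t : ℂ) • z) z) (ω' z t) z := by
    intro z hz t ht
    have h1 : HasFDerivAt (fun z : E => (t : ℂ) • z) ((t : ℂ) • ContinuousLinearMap.id ℂ E) z :=
      (hasFDerivAt_id z).const_smul _
    have h2 := ((hsmul z hz t ht).comp z h1).clm_apply (hasFDerivAt_id z)
    refine h2.congr_fderiv ?_
    ext v
    simp [hω']
  have hmaps : ∀ z ∈ ball (0 : E) r, MapsTo (fun t : ℝ => (t : ℂ) • z) (Icc 0 1) (ball 0 r) :=
    fun z hz t ht => ofReal_smul_mem_ball hz ht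
  have hpath : ∀ z : E, Continuous fun t : ℝ => (t : ℂ) • z := fun z => by fun_prop
  have hc1 : ∀ z ∈ ball (0 : E) r, ContinuousOn (fun t : ℝ => ω ((t : ℂ) • z)) (Icc 0 1) :=
    fun z hz => hω.continuousOn.comp (hpath z).continuousOn (hmaps z hz)
  have hc2 : ∀ z ∈ ball (0 : E) r, ContinuousOn (ω' z) (Icc 0 1) := by
    intro z hz
    have h := hdω.continuousOn.comp (hpath z).continuousOn (hmaps z hz)
    refine (hc1 z hz).add (Complex.continuous_ofReal.continuousOn.smul ?_)
    refine ContinuousOn.clm_apply ?_ continuousOn_const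
    exact (ContinuousLinearMap.flipₗᵢ ℂ E E F).continuous.comp_continuousOn h
  have hc3 : ∀ z ∈ ball (0 : E) r, ContinuousOn (fun t : ℝ => ω ((t : ℂ) • z) z) (Icc 0 1) :=
    fun z hz => (hc1 z hz).clm_apply continuousOn_const
  have hint : IntervalIntegrable (ω' z) MeasureTheory.volume 0 1 := by
    refine ContinuousOn.intervalIntegrable ?_
    rw [uIcc_of_le zero_le_one]
    exact hc2 z hz
  refine ⟨∫ t in (0 : ℝ)..1, ω' z t, ?_, ?_⟩
  · obtain ⟨ρ, hzρ, hρr⟩ := exists_between (mem_ball_zero_iff.1 hz)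
    have hsub : closedBall (0 : E) ρ ⊆ ball 0 r := closedBall_subset_ball hρr
    obtain ⟨C₁, hC₁⟩ := (isCompact_closedBall (0 : E) ρ).exists_bound_of_continuousOn
      (hω.continuousOn.mono hsub)
    obtain ⟨C₂, hC₂⟩ := (isCompact_closedBall (0 : E) ρ).exists_bound_of_continuousOn
      (hdω.continuousOn.mono hsub)
    have hzmem : ball (0 : E) ρ ∈ 𝓝 z := isOpen_ball.mem_nhds (mem_ball_zero_iff.2 hzρ)
    refine intervalIntegral.hasFDerivAt_integral_of_dominated_of_fderiv_le
      (bound := fun _ => C₁ + C₂ * ρ) hzmem ?_ ?_ ?_ ?_ ?_ ?_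
    · filter_upwards [hzmem] with w hw
      have := ((hc3 w (hsub (ball_subset_closedBall hw))).mono Ioc_subset_Icc_self).aestronglyMeasurable
        measurableSet_Ioc (μ := MeasureTheory.volume)
      rwa [uIoc_of_le zero_le_one]
    · refine ContinuousOn.intervalIntegrable ?_
      rw [uIcc_of_le zero_le_one]
      exact hc3 z hz
    · exact hint.def'.aestronglyMeasurable
    · refine Eventually.of_forall fun t ht w hw => ?_
      rw [uIoc_of_le zero_le_one] at ht
      have ht' : t ∈ Icc (0 : ℝ) 1 := ⟨ht.1.le, ht.2⟩
      have hwt := ball_subset_closedBall (ofReal_smul_mem_ball hw ht')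
      have hw' := mem_ball_zero_iff.1 hw
      refine (norm_add_le _ _).trans (add_le_add (hC₁ _ hwt) ?_)
      rw [norm_smul, Complex.norm_real, Real.norm_eq_abs, abs_of_nonneg ht.1.le]
      have h1 : ‖(fderiv ℂ ω ((t : ℂ) • w)).flip w‖ ≤ C₂ * ρ := by
        refine ((fderiv ℂ ω ((t : ℂ) • w)).flip.le_opNorm w).trans ?_
        rw [ContinuousLinearMap.opNorm_flip]
        exact mul_le_mul (hC₂ _ hwt) hw'.le (norm_nonneg _) ((norm_nonneg _).trans (hC₂ _ hwt))
      nlinarith [norm_nonneg ((fderiv ℂ ω ((t : ℂ) • w)).flip w), ht.1, ht.2]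
    · simp
    · refine Eventually.of_forall fun t ht w hw => ?_
      rw [uIoc_of_le zero_le_one] at ht
      exact hdiff w (hsub (ball_subset_closedBall hw)) t ⟨ht.1.le, ht.2⟩
  · -- along the ray, `ω' z t z` is the derivative of `t ω(t z) z`
    rw [ContinuousLinearMap.intervalIntegral_apply hint]
    have hd : ∀ t ∈ uIcc (0 : ℝ) 1,
        HasDerivAt (fun t : ℝ => (t : ℂ) • ω ((t : ℂ) • z) z) (ω' z t z) t := by
      intro t ht
      rw [uIcc_of_le zero_le_one] at ht
      have h1 : HasDerivAt (fun t : ℝ => ω ((t : ℂ) • z)) (fderiv ℂ ω ((t : ℂ) • z) z) t := by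
        have h0 := (hsmul z hz t ht).restrictScalars ℝ
        exact h0.comp_hasDerivAt t (hasDerivAt_ofReal_smul z t)
      have h2 : HasDerivAt (fun t : ℝ => ω ((t : ℂ) • z) z) (fderiv ℂ ω ((t : ℂ) • z) z z) t :=
        (((ContinuousLinearMap.apply ℂ F z).restrictScalars ℝ).hasFDerivAt).comp_hasDerivAt t h1
      have h3 := (Complex.ofRealCLM.hasDerivAt (x := t)).smul h2
      refine h3.congr_deriv ?_
      simp [hω', add_comm]
    rw [intervalIntegral.integral_eq_sub_of_hasDerivAt hd]
    · simp
    · refine ContinuousOn.intervalIntegrable ?_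
      rw [uIcc_of_le zero_le_one]
      exact (hc2 z hz).clm_apply continuousOn_const

/-- A normally convergent series of holomorphic functions may be differentiated term by term. -/
theorem hasFDerivAt_tsum_of_norm_le {E F : Type*} [NormedAddCommGroup E] [NormedSpace ℂ E]
    [NormedAddCommGroup F] [NormedSpace ℂ F] [CompleteSpace F] {m : ℕ → E → F} {u : ℕ → ℝ} {r : ℝ}
    (hu : Summable u) (hm : ∀ k, DifferentiableOn ℂ (m k) (ball 0 r))
    (hb : ∀ k, ∀ z ∈ ball (0 : E) r, ‖m k z‖ ≤ u k) {z : E} (hz : z ∈ ball (0 : E) (r / 2)) :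
    Summable (fun k => fderiv ℂ (m k) z) ∧
      HasFDerivAt (fun z => ∑' k, m k z) (∑' k, fderiv ℂ (m k) z) z := by
  have hr : 0 < r / 2 := (norm_nonneg z).trans_lt (mem_ball_zero_iff.1 hz)
  have hsub : ball (0 : E) (r / 2) ⊆ ball 0 r := ball_subset_ball (by linarith)
  have hbound : ∀ k, ∀ z ∈ ball (0 : E) (r / 2), ‖fderiv ℂ (m k) z‖ ≤ u k / (r / 2) := by
    intro k z hz
    have hcb : closedBall z (r / 2) ⊆ ball 0 r := by
      intro w hw
      have h1 := dist_triangle w z 0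
      have h2 : dist w z ≤ r / 2 := hw
      have h3 : dist z 0 < r / 2 := hz
      rw [mem_ball]
      linarith
    exact norm_fderiv_le_of_forall_mem_closedBall isOpen_ball (hm k) hr hcb
      fun w hw => hb k w (hcb hw)
  refine ⟨(hu.div_const _).of_norm_bounded (fun k => hbound k z hz),
    hasFDerivAt_tsum_of_isPreconnected (hu.div_const (r / 2)) isOpen_ball
      (convex_ball (0 : E) (r / 2)).isPreconnected (fun k w hw => ?_) hbound hz
      (hu.of_norm_bounded fun k => hb k z (hsub hz)) hz⟩
  exact ((hm k).differentiableAt (isOpen_ball.mem_nhds (hsub hw))).hasFDerivAt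

/-! ### Local parallel frames of a flat holomorphic connection -/

/-- The connection `d - A` on the trivial bundle with fibre the algebra `B`, acting by
`M ↦ dM - M A`, has zero curvature on `U`. -/
def IsFlatConnectionOn {E B : Type*} [NormedAddCommGroup E] [NormedSpace ℂ E] [NormedRing B]
    [NormedAlgebra ℂ B] (A : E → E →L[ℂ] B) (U : Set E) : Prop :=
  ∀ z ∈ U, ∀ v w, fderiv ℂ A z v w + A z v * A z w = fderiv ℂ A z w v + A z w * A z v

/-- The function `M` is parallel at `z` for the connection `A`: `dM = M A`. -/
def IsParallelAt {E B : Type*} [NormedAddCommGroup E] [NormedSpace ℂ E] [NormedRing B]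
    [NormedAlgebra ℂ B] (A : E → E →L[ℂ] B) (M : E → B) (z : E) : Prop :=
  HasFDerivAt M ((ContinuousLinearMap.mul ℂ B (M z)).comp (A z)) z

/-- Picard iteration along rays. Each iterate is holomorphic, so their sum is. -/
theorem exists_radial_solution {E B : Type*} [NormedAddCommGroup E] [NormedSpace ℂ E]
    [FiniteDimensional ℂ E] [NormedRing B] [NormedAlgebra ℂ B] [FiniteDimensional ℂ B]
    {A : E → E →L[ℂ] B} {r : ℝ} (hr : 0 < r) (hA : DifferentiableOn ℂ A (ball 0 r)) :
    ∃ ρ > 0, ρ ≤ r ∧ ∃ M : E → B, M 0 = 1 ∧ DifferentiableOn ℂ M (ball 0 ρ) ∧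
      ∀ z ∈ ball 0 ρ, fderiv ℂ M z z = M z * A z z := by
  have : CompleteSpace B := FiniteDimensional.complete ℂ B
  have : ProperSpace E := FiniteDimensional.proper ℂ E
  obtain ⟨C, hC⟩ := (isCompact_closedBall (0 : E) (r / 2)).exists_bound_of_continuousOn
    (hA.continuousOn.mono (closedBall_subset_ball (by linarith)))
  have hC0 : 0 ≤ C := (norm_nonneg _).trans (hC 0 (mem_closedBall_self (by positivity)))
  -- on the ball of radius `s` the Picard operator has norm at most `1 / 2`
  obtain ⟨s, hs0, hsr, hsC⟩ : ∃ s > 0, s ≤ r / 2 ∧ C * s ≤ 1 / 2 := by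
    refine ⟨min (r / 2) (1 / (2 * (C + 1))), by positivity, min_le_left _ _, ?_⟩
    calc C * min (r / 2) (1 / (2 * (C + 1))) ≤ C * (1 / (2 * (C + 1))) :=
          mul_le_mul_of_nonneg_left (min_le_right _ _) hC0
      _ ≤ 1 / 2 := by
          rw [mul_one_div, div_le_div_iff₀ (by positivity) (by norm_num)]
          linarith
  have hAs : DifferentiableOn ℂ A (ball 0 s) := hA.mono (ball_subset_ball (by linarith))
  have hCs : ∀ z ∈ ball (0 : E) s, ‖A z‖ ≤ C := fun z hz =>
    hC z (ball_subset_closedBall (ball_subset_ball hsr hz))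
  let form : (E → B) → E → E →L[ℂ] B := fun m z => (ContinuousLinearMap.mul ℂ B (m z)).comp (A z)
  have hform : ∀ m : E → B, DifferentiableOn ℂ m (ball 0 s) →
      DifferentiableOn ℂ (form m) (ball 0 s) := fun m hm =>
    ((ContinuousLinearMap.mul ℂ B).differentiable.comp_differentiableOn hm).clm_comp hAs
  let m : ℕ → E → B := fun k => Nat.rec (fun _ => 1)
    (fun _ m z => ∫ t in (0 : ℝ)..1, form m ((t : ℂ) • z) z) k
  have hsucc : ∀ k, m (k + 1) = fun z => ∫ t in (0 : ℝ)..1, form (m k) ((t : ℂ) • z) z :=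
    fun k => rfl
  have hm : ∀ k, DifferentiableOn ℂ (m k) (ball 0 s) := by
    intro k
    induction k with
    | zero => exact differentiableOn_const _
    | succ k ih =>
      rw [hsucc]
      intro z hz
      obtain ⟨L, hL, -⟩ := hasFDerivAt_radial_integral (hform _ ih) hz
      exact hL.differentiableAt.differentiableWithinAt
  have hb : ∀ k, ∀ z ∈ ball (0 : E) s, ‖m k z‖ ≤ ‖(1 : B)‖ * (1 / 2) ^ k := by
    intro k
    induction k with
    | zero => intro z _; simp [m]
    | succ k ih =>
      intro z hz
      have h : ∀ t ∈ uIoc (0 : ℝ) 1,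
          ‖form (m k) ((t : ℂ) • z) z‖ ≤ ‖(1 : B)‖ * (1 / 2) ^ (k + 1) := by
        intro t ht
        rw [uIoc_of_le zero_le_one] at ht
        have htz := ofReal_smul_mem_ball hz (⟨ht.1.le, ht.2⟩ : t ∈ Icc (0 : ℝ) 1)
        have h1 : ‖A ((t : ℂ) • z) z‖ ≤ 1 / 2 := by
          refine ((A ((t : ℂ) • z)).le_opNorm z).trans (le_trans ?_ hsC)
          exact mul_le_mul (hCs _ htz) (mem_ball_zero_iff.1 hz).le (norm_nonneg _) hC0
        calc ‖m k ((t : ℂ) • z) * A ((t : ℂ) • z) z‖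
            ≤ ‖m k ((t : ℂ) • z)‖ * ‖A ((t : ℂ) • z) z‖ := norm_mul_le _ _
          _ ≤ (‖(1 : B)‖ * (1 / 2) ^ k) * (1 / 2) :=
              mul_le_mul (ih _ htz) h1 (norm_nonneg _) (by positivity)
          _ = ‖(1 : B)‖ * (1 / 2) ^ (k + 1) := by ring
      rw [hsucc]
      simpa using intervalIntegral.norm_integral_le_of_norm_le_const h
  have hu : Summable fun k : ℕ => ‖(1 : B)‖ * (1 / 2 : ℝ) ^ k :=
    summable_geometric_two.mul_left _
  refine ⟨s / 2, by positivity, by linarith, fun z => ∑' k, m k z, ?_, ?_, ?_⟩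
  · change ∑' k, m k 0 = 1
    rw [tsum_eq_single 0]
    · rfl
    · intro k hk
      obtain ⟨k, rfl⟩ := Nat.exists_eq_succ_of_ne_zero hk
      rw [Nat.succ_eq_add_one, hsucc]
      simp
  · exact fun z hz =>
      (hasFDerivAt_tsum_of_norm_le hu hm hb hz).2.differentiableAt.differentiableWithinAt
  · intro z hz
    have hzs : z ∈ ball (0 : E) s := ball_subset_ball (by linarith) hz
    obtain ⟨hsum, hder⟩ := hasFDerivAt_tsum_of_norm_le hu hm hb hz
    have hsum0 : Summable fun k => m k z := hu.of_norm_bounded fun k => hb k z hzs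
    have happ : Summable fun k => fderiv ℂ (m k) z z :=
      hsum.mapL (ContinuousLinearMap.apply ℂ B z)
    have hstep : ∀ k, fderiv ℂ (m (k + 1)) z z = m k z * A z z := by
      intro k
      obtain ⟨L, hL, hLz⟩ := hasFDerivAt_radial_integral (hform _ (hm k)) hzs
      rw [hsucc, hL.fderiv, hLz]
      rfl
    have hzero : fderiv ℂ (m 0) z z = 0 := by
      have : m 0 = fun _ => 1 := rfl
      simp [this]
    rw [hder.fderiv]
    change (ContinuousLinearMap.apply ℂ B z) (∑' k, fderiv ℂ (m k) z) = _
    rw [ContinuousLinearMap.map_tsum _ hsum]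
    change ∑' k, fderiv ℂ (m k) z z = _
    rw [happ.tsum_eq_zero_add, hzero, zero_add, ← hsum0.tsum_mul_right]
    exact tsum_congr hstep

/-- For a flat connection, a function which is parallel in the radial direction is parallel: the
defect `ω = dM - M A` satisfies a homogeneous linear differential equation along rays. -/
theorem isParallelAt_of_radial {E B : Type*} [NormedAddCommGroup E] [NormedSpace ℂ E]
    [FiniteDimensional ℂ E] [NormedRing B] [NormedAlgebra ℂ B] [FiniteDimensional ℂ B]
    {A : E → E →L[ℂ] B} {r : ℝ} (hA : DifferentiableOn ℂ A (ball 0 r))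
    (hflat : IsFlatConnectionOn A (ball 0 r)) {M : E → B}
    (hM : DifferentiableOn ℂ M (ball 0 r))
    (hrad : ∀ z ∈ ball (0 : E) r, fderiv ℂ M z z = M z * A z z) {z : E} (hz : z ∈ ball 0 r) :
    IsParallelAt A M z := by
  have hdM := differentiableOn_fderiv_complex hM isOpen_ball
  have hMat : ∀ y ∈ ball (0 : E) r, HasFDerivAt M (fderiv ℂ M y) y := fun y hy =>
    (hM.differentiableAt (isOpen_ball.mem_nhds hy)).hasFDerivAt
  have hAat : ∀ y ∈ ball (0 : E) r, HasFDerivAt A (fderiv ℂ A y) y := fun y hy =>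
    (hA.differentiableAt (isOpen_ball.mem_nhds hy)).hasFDerivAt
  have hdMat : ∀ y ∈ ball (0 : E) r, HasFDerivAt (fderiv ℂ M) (fderiv ℂ (fderiv ℂ M) y) y :=
    fun y hy => (hdM.differentiableAt (isOpen_ball.mem_nhds hy)).hasFDerivAt
  have hsymm : ∀ y ∈ ball (0 : E) r, ∀ v w,
      fderiv ℂ (fderiv ℂ M) y v w = fderiv ℂ (fderiv ℂ M) y w v := fun y hy v w =>
    second_derivative_symmetric_of_eventually
      (eventually_of_mem (isOpen_ball.mem_nhds hy) hMat) (hdMat y hy) v w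
  set ω : E → E →L[ℂ] B := fun y => fderiv ℂ M y - (ContinuousLinearMap.mul ℂ B (M y)).comp (A y)
  have hωapp : ∀ y v, ω y v = fderiv ℂ M y v - M y * A y v := fun y v => rfl
  -- the derivative of the defect in a fixed direction `w`
  have hωdiff : ∀ y ∈ ball (0 : E) r, DifferentiableAt ℂ ω y := fun y hy =>
    (hdMat y hy).differentiableAt.sub
      ((((ContinuousLinearMap.mul ℂ B).differentiableAt).comp y (hMat y hy).differentiableAt).clm_comp
        (hAat y hy).differentiableAt)
  have hdω : ∀ y ∈ ball (0 : E) r, ∀ v w, fderiv ℂ ω y v w =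
      fderiv ℂ (fderiv ℂ M) y v w - (M y * fderiv ℂ A y v w + fderiv ℂ M y v * A y w) := by
    intro y hy v w
    have h1 : HasFDerivAt (fun y => ω y w) ((fderiv ℂ ω y).flip w) y := by
      simpa using (hωdiff y hy).hasFDerivAt.clm_apply (hasFDerivAt_const w y)
    have h2 : HasFDerivAt (fun y => A y w) ((fderiv ℂ A y).flip w) y := by
      simpa using (hAat y hy).clm_apply (hasFDerivAt_const w y)
    have h3 : HasFDerivAt (fun y => fderiv ℂ M y w) ((fderiv ℂ (fderiv ℂ M) y).flip w) y := by
      simpa using (hdMat y hy).clm_apply (hasFDerivAt_const w y)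
    have h4 := h3.sub ((hMat y hy).mul' h2)
    have := congrArg (fun L : E →L[ℂ] B => L v) (h1.unique h4)
    simpa using this
  have hωrad : ∀ y ∈ ball (0 : E) r, ω y y = 0 := fun y hy => by
    rw [hωapp, hrad y hy, sub_self]
  have hradial : ∀ y ∈ ball (0 : E) r, ∀ v, fderiv ℂ ω y v y + ω y v = 0 := by
    intro y hy v
    have h1 := (hωdiff y hy).hasFDerivAt.clm_apply (hasFDerivAt_id y)
    have h2 : HasFDerivAt (fun y => ω y y) (0 : E →L[ℂ] B) y :=
      (hasFDerivAt_const (0 : B) y).congr_of_eventuallyEq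
        (eventually_of_mem (isOpen_ball.mem_nhds hy) hωrad)
    have := congrArg (fun L : E →L[ℂ] B => L v) (h1.unique h2)
    simpa [add_comm] using this
  have hode : ∀ y ∈ ball (0 : E) r, ∀ v, ω y v + fderiv ℂ ω y y v = ω y v * A y y := by
    intro y hy v
    have e1 := hradial y hy v
    have e2 := hdω y hy v y
    have e3 := hdω y hy y v
    have e4 := hsymm y hy v y
    have e5 := congrArg (M y * ·) (hflat y hy v y)
    have e6 := hrad y hy
    simp only [mul_add, ← mul_assoc] at e5
    rw [e6] at e3
    have e7 : fderiv ℂ ω y y v = fderiv ℂ ω y v y + ω y v * A y y := by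
      rw [e2, e3, e4, hωapp, sub_mul]
      linear_combination (norm := noncomm_ring) e5
    rw [e7]
    linear_combination (norm := noncomm_ring) e1
  suffices h : ω z = 0 from (hMat z hz).congr_fderiv (sub_eq_zero.1 h)
  ext v
  have hmaps : MapsTo (fun t : ℝ => (t : ℂ) • z) (Icc 0 1) (ball 0 r) :=
    fun t ht => ofReal_smul_mem_ball hz ht
  have hcA : ContinuousOn (fun t : ℝ => A ((t : ℂ) • z) z) (Icc 0 1) :=
    (hA.continuousOn.comp (f := fun t : ℝ => (t : ℂ) • z)
      (Continuous.continuousOn (by fun_prop)) hmaps).clm_apply continuousOn_const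
  obtain ⟨K, hK⟩ := isCompact_Icc.exists_bound_of_continuousOn hcA
  have hd : ∀ t ∈ Icc (0 : ℝ) 1, HasDerivAt (fun t : ℝ => (t : ℂ) • ω ((t : ℂ) • z) v)
      (((t : ℂ) • ω ((t : ℂ) • z) v) * A ((t : ℂ) • z) z) t := by
    intro t ht
    have h0 := (hωdiff _ (hmaps ht)).hasFDerivAt.restrictScalars ℝ
    have h1 : HasDerivAt (fun t : ℝ => ω ((t : ℂ) • z)) (fderiv ℂ ω ((t : ℂ) • z) z) t :=
      h0.comp_hasDerivAt t (hasDerivAt_ofReal_smul z t)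
    have h2 : HasDerivAt (fun t : ℝ => ω ((t : ℂ) • z) v) (fderiv ℂ ω ((t : ℂ) • z) z v) t :=
      (((ContinuousLinearMap.apply ℂ B v).restrictScalars ℝ).hasFDerivAt).comp_hasDerivAt t h1
    have h3 := (Complex.ofRealCLM.hasDerivAt (x := t)).smul h2
    refine h3.congr_deriv ?_
    have h4 := hode _ (hmaps ht) v
    simp only [map_smul, smul_apply] at h4
    simp only [Complex.ofRealCLM_apply, Complex.ofReal_one, one_smul]
    rw [smul_mul_assoc, ← mul_smul_comm, ← h4, add_comm]
  have key := eq_zero_of_abs_deriv_le_mul_abs_self_of_eq_zero_right (a := 0) (b := 1) (K := K)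
    (f := fun t : ℝ => (t : ℂ) • ω ((t : ℂ) • z) v)
    (fun t ht => (hd t ht).continuousAt.continuousWithinAt)
    (fun t ht => (hd t (Ico_subset_Icc_self ht)).hasDerivWithinAt) (by simp)
    (fun t ht => by
      refine (norm_mul_le _ _).trans ?_
      rw [mul_comm]
      exact mul_le_mul_of_nonneg_right (hK t (Ico_subset_Icc_self ht)) (norm_nonneg _))
    1 (right_mem_Icc.2 zero_le_one)
  simpa using key

/-- A flat holomorphic connection has invertible parallel sections near every point. -/
theorem IsFlatConnectionOn.exists_isParallelAt {E B : Type*} [NormedAddCommGroup E]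
    [NormedSpace ℂ E] [FiniteDimensional ℂ E] [NormedRing B] [NormedAlgebra ℂ B]
    [FiniteDimensional ℂ B] {A : E → E →L[ℂ] B} {U : Set E} (hU : IsOpen U)
    (hA : DifferentiableOn ℂ A U) (hflat : IsFlatConnectionOn A U) {p : E} (hp : p ∈ U) :
    ∃ V ⊆ U, IsOpen V ∧ p ∈ V ∧ ∃ M : E → B, ∀ z ∈ V, IsUnit (M z) ∧ IsParallelAt A M z := by
  have : CompleteSpace B := FiniteDimensional.complete ℂ B
  obtain ⟨r, hr, hrU⟩ := Metric.isOpen_iff.1 hU p hp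
  have hmaps : ∀ z ∈ ball (0 : E) r, p + z ∈ U := fun z hz => hrU (by simpa using hz)
  have htrans : ∀ z : E, HasFDerivAt (fun z => p + z) (ContinuousLinearMap.id ℂ E) z :=
    fun z => (hasFDerivAt_id z).const_add p
  have hder : ∀ z ∈ ball (0 : E) r,
      HasFDerivAt (fun z => A (p + z)) (fderiv ℂ A (p + z)) z := fun z hz => by
    have h := (hA.differentiableAt (hU.mem_nhds (hmaps z hz))).hasFDerivAt.comp z (htrans z)
    rwa [ContinuousLinearMap.comp_id] at h
  have hA' : DifferentiableOn ℂ (fun z => A (p + z)) (ball 0 r) := fun z hz =>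
    (hder z hz).differentiableAt.differentiableWithinAt
  obtain ⟨ρ, hρ, hρr, M, hM0, hM, hrad⟩ := exists_radial_solution hr hA'
  have hsub : ball (0 : E) ρ ⊆ ball 0 r := ball_subset_ball hρr
  have hflat' : IsFlatConnectionOn (fun z => A (p + z)) (ball 0 ρ) := fun z hz v w => by
    rw [(hder z (hsub hz)).fderiv]
    exact hflat _ (hmaps z (hsub hz)) v w
  have hpar : ∀ z ∈ ball (0 : E) ρ, IsParallelAt (fun z => A (p + z)) M z := fun z hz =>
    isParallelAt_of_radial (hA'.mono hsub) hflat' hM hrad hz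
  have hback : ContinuousOn (fun z => M (z - p)) (ball p ρ) :=
    hM.continuousOn.comp (by fun_prop) fun z hz => by
      simpa [dist_eq_norm] using hz
  refine ⟨ball p ρ ∩ (fun z => M (z - p)) ⁻¹' {b | IsUnit b}, ?_,
    hback.isOpen_inter_preimage isOpen_ball Units.isOpen, ⟨mem_ball_self hρ, by simp [hM0]⟩,
    fun z => M (z - p), fun z hz => ⟨hz.2, ?_⟩⟩
  · exact fun z hz => hrU (ball_subset_ball hρr hz.1)
  · have hz' : z - p ∈ ball (0 : E) ρ := by simpa [dist_eq_norm] using hz.1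
    have h0 : HasFDerivAt M _ (z - p) := hpar _ hz'
    have h := h0.comp z ((hasFDerivAt_id z).sub_const p)
    unfold IsParallelAt
    simpa [Function.comp_def] using h

/-! ### Continuation over simply connected spaces -/

/-- **Monodromy.** Suppose that every point `p` has a neighbourhood `U p` with a function `Φ p` on
it, and that any two of these functions differ on the overlap of their domains by a locally
constant left factor. Then on a simply connected space there is a global function which differs
from each of them by a locally constant left factor. It is read off from a section of the covering
space whose fibres are the possible left factors. -/
theorem exists_global_of_locally_const_transition {X G : Type*} [TopologicalSpace X]
    [SimplyConnectedSpace X] [LocallyPathConnectedSpace X] [Group G] {U : X → Set X}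
    (hU : ∀ p, IsOpen (U p)) (hmem : ∀ p, p ∈ U p) (Φ : X → X → G)
    (h : ∀ p q, ∀ x ∈ U p ∩ U q, ∀ᶠ y in 𝓝 x, Φ p y * (Φ q y)⁻¹ = Φ p x * (Φ q x)⁻¹) :
    ∃ Ψ : X → G, ∀ p, ∀ x ∈ U p, ∀ᶠ y in 𝓝 x, Ψ y * (Φ p y)⁻¹ = Ψ x * (Φ p x)⁻¹ := by
  let _ : TopologicalSpace G := ⊥
  have : DiscreteTopology G := ⟨rfl⟩
  let Z : FiberBundleCore X X G :=
    { baseSet := U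
      isOpen_baseSet := hU
      indexAt := id
      mem_baseSet_at := hmem
      coordChange := fun p q x g => g * (Φ p x * (Φ q x)⁻¹)
      coordChange_self := fun p x _ g => by simp
      continuousOn_coordChange := by
        rintro p q ⟨x, g⟩ ⟨hx, -⟩
        refine ContinuousAt.continuousWithinAt ?_
        have hev : ∀ᶠ y : X × G in 𝓝 (x, g),
            y.2 * (Φ p y.1 * (Φ q y.1)⁻¹) = g * (Φ p x * (Φ q x)⁻¹) := by
          rw [nhds_prod_eq, nhds_discrete G]
          have h1 : ∀ᶠ y : X × G in 𝓝 x ×ˢ pure g, y.2 = g :=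
            tendsto_snd.eventually (by simp : ∀ᶠ y in pure g, y = g)
          filter_upwards [tendsto_fst.eventually (h p q x hx), h1] with y hy hy'
          rw [hy, hy']
        exact (continuousAt_const (y := g * (Φ p x * (Φ q x)⁻¹))).congr
          (hev.mono fun y hy => hy.symm)
      coordChange_comp := fun p q r x _ g => by group }
  have hcov : IsCoveringMap (Bundle.TotalSpace.proj : Z.TotalSpace → X) :=
    FiberBundle.isCoveringMap (F := G) (E := Z.Fiber)
  obtain ⟨x₀⟩ : Nonempty X := inferInstance
  obtain ⟨s, ⟨-, hs⟩, -⟩ := hcov.existsUnique_continuousMap_lifts (ContinuousMap.id X) x₀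
    (⟨x₀, (1 : G)⟩ : Z.TotalSpace) rfl
  have hproj : ∀ y, (s y).proj = y := fun y => congrFun hs y
  let c : X → G := fun y => (s y).snd
  refine ⟨fun y => c y * Φ y y, fun p x hx => ?_⟩
  have hcont : ContinuousAt (fun y => (Z.localTriv p (s y)).2) x := by
    have hsrc : s x ∈ (Z.localTriv p).source := by
      rw [Z.mem_localTriv_source, hproj]
      exact hx
    exact continuousAt_snd.comp
      (((Z.localTriv p).continuousAt hsrc).comp s.continuous.continuousAt)
  have heq : ∀ y, (Z.localTriv p (s y)).2 = c y * Φ y y * (Φ p y)⁻¹ := by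
    intro y
    have h1 : (Z.localTriv p (s y)).2 =
        c y * (Φ (s y).proj (s y).proj * (Φ p (s y).proj)⁻¹) := rfl
    rw [h1, hproj, mul_assoc]
  have hev := hcont.eventually (show ∀ᶠ g in 𝓝 (Z.localTriv p (s x)).2,
    g = (Z.localTriv p (s x)).2 by simp [nhds_discrete])
  filter_upwards [hev] with y hy
  rwa [heq, heq] at hy

/-- A closed holomorphic `1`-form on a simply connected open set has a primitive. -/
theorem exists_primitive_of_closed {E F : Type*} [NormedAddCommGroup E] [NormedSpace ℂ E]
    [NormedAddCommGroup F] [NormedSpace ℂ F] [CompleteSpace F]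
    {Ω : Set E} (hΩ : IsOpen Ω) [SimplyConnectedSpace Ω] {ω : E → E →L[ℂ] F}
    (hω : DifferentiableOn ℂ ω Ω)
    (hclosed : ∀ z ∈ Ω, ∀ v w, fderiv ℂ ω z v w = fderiv ℂ ω z w v) :
    ∃ f : E → F, ∀ z ∈ Ω, HasFDerivAt f (ω z) z := by
  have : LocallyPathConnectedSpace Ω := hΩ.locallyPathConnectedSpace
  have hloc : ∀ p : Ω, ∃ V : Set E, IsOpen V ∧ (p : E) ∈ V ∧ ∃ g : E → F,
      ∀ z ∈ V, HasFDerivAt g (ω z) z := by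
    intro p
    obtain ⟨r, hr, hrΩ⟩ := Metric.isOpen_iff.1 hΩ p p.2
    have hd : ∀ a ∈ ball (p : E) r, HasFDerivAt ω (fderiv ℂ ω a) a := fun a ha =>
      (hω.differentiableAt (hΩ.mem_nhds (hrΩ ha))).hasFDerivAt
    obtain ⟨g, hg⟩ :=
      (convex_ball (p : E) r).exists_forall_hasFDerivWithinAt_of_hasFDerivWithinAt_symmetric
        (dω := fun a => (fderiv ℂ ω a).restrictScalars ℝ)
        (fun a ha => ((hd a ha).restrictScalars ℝ).hasFDerivWithinAt)
        (fun a ha v _ w _ => hclosed a (hrΩ ha) v w)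
    exact ⟨ball p r, isOpen_ball, mem_ball_self hr, g, fun z hz =>
      (hg z hz).hasFDerivAt (isOpen_ball.mem_nhds hz)⟩
  choose V hVo hpV g hg using hloc
  obtain ⟨Ψ, hΨ⟩ := exists_global_of_locally_const_transition (G := Multiplicative F)
    (U := fun p : Ω => Subtype.val ⁻¹' V p) (fun p => (hVo p).preimage continuous_subtype_val)
    (fun p => hpV p) (fun p x => Multiplicative.ofAdd (g p x)) (by
      rintro p q x ⟨hxp, hxq⟩
      have hopen : IsOpen (V p ∩ V q) := (hVo p).inter (hVo q)
      have hd : ∀ z ∈ V p ∩ V q, HasFDerivAt (fun z => g p z - g q z) (0 : E →L[ℂ] F) z :=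
        fun z hz =>
          ((hg p z hz.1).sub (hg q z hz.2)).congr_fderiv (sub_self _)
      have h0 := hopen.isOpen_inter_preimage_of_fderiv_eq_zero
        (fun z hz => (hd z hz).differentiableAt.differentiableWithinAt)
        (fun z hz => (hd z hz).fderiv) {g p x - g q x}
      have h1 := continuous_subtype_val.continuousAt.eventually (h0.mem_nhds ⟨⟨hxp, hxq⟩, rfl⟩)
      filter_upwards [h1] with y hy
      have h2 : g p y - g q y = g p x - g q x := hy.2
      rw [← ofAdd_neg, ← ofAdd_neg, ← ofAdd_add, ← ofAdd_add, ← sub_eq_add_neg, ← sub_eq_add_neg,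
        h2])
  classical
  refine ⟨fun z => if hz : z ∈ Ω then (Ψ ⟨z, hz⟩).toAdd else 0, fun z hz => ?_⟩
  have h1 := hΨ ⟨z, hz⟩ ⟨z, hz⟩ (hpV _)
  rw [nhds_subtype_eq_comap, eventually_comap] at h1
  have h2 := ((hg ⟨z, hz⟩ z (hpV ⟨z, hz⟩)).add_const
    ((Ψ ⟨z, hz⟩).toAdd - g ⟨z, hz⟩ z))
  refine h2.congr_of_eventuallyEq ?_
  filter_upwards [h1, hΩ.mem_nhds hz] with y hy hyΩ
  have h3 := congrArg Multiplicative.toAdd (hy ⟨y, hyΩ⟩ rfl)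
  simp only [toAdd_mul, toAdd_inv, toAdd_ofAdd] at h3
  rw [dif_pos hyΩ]
  rw [← sub_eq_add_neg, ← sub_eq_add_neg, sub_eq_iff_eq_add] at h3
  rw [h3, add_comm]

/-- A flat holomorphic connection on a simply connected open set has a global invertible parallel
section. -/
theorem IsFlatConnectionOn.exists_global {E B : Type*} [NormedAddCommGroup E]
    [NormedSpace ℂ E] [FiniteDimensional ℂ E] [NormedRing B] [NormedAlgebra ℂ B]
    [FiniteDimensional ℂ B] {A : E → E →L[ℂ] B} {Ω : Set E} (hΩ : IsOpen Ω)
    [SimplyConnectedSpace Ω] (hA : DifferentiableOn ℂ A Ω) (hflat : IsFlatConnectionOn A Ω) :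
    ∃ M : E → B, ∀ z ∈ Ω, IsUnit (M z) ∧ IsParallelAt A M z := by
  have : CompleteSpace B := FiniteDimensional.complete ℂ B
  have : LocallyPathConnectedSpace Ω := hΩ.locallyPathConnectedSpace
  have hloc := fun p : Ω => hflat.exists_isParallelAt hΩ hA p.2
  choose V _ hVo hpV N hN using hloc
  classical
  let Φ : Ω → Ω → Bˣ := fun p x => if hx : (x : E) ∈ V p then (hN p x hx).1.unit else 1
  have hΦ : ∀ p (x : Ω), (x : E) ∈ V p → (Φ p x : B) = N p x := fun p x hx => by
    simp [Φ, hx]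
  have hΦinv : ∀ p (x : Ω), (x : E) ∈ V p → ((Φ p x)⁻¹ : Bˣ) = Ring.inverse (N p x) :=
    fun p x hx => by rw [← hΦ p x hx, Ring.inverse_unit]
  obtain ⟨Ψ, hΨ⟩ := exists_global_of_locally_const_transition
    (U := fun p : Ω => Subtype.val ⁻¹' V p) (fun p => (hVo p).preimage continuous_subtype_val)
    (fun p => hpV p) Φ (by
      rintro p q x ⟨hxp, hxq⟩
      have hopen : IsOpen (V p ∩ V q) := (hVo p).inter (hVo q)
      have hd : ∀ z ∈ V p ∩ V q,
          HasFDerivAt (fun z => N p z * Ring.inverse (N q z)) (0 : E →L[ℂ] B) z := by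
        intro z hz
        obtain ⟨u, hu⟩ := (hN q z hz.2).1
        have hp : HasFDerivAt (N p) _ z := (hN p z hz.1).2
        have hq : HasFDerivAt (N q) _ z := (hN q z hz.2).2
        have hinv := hasFDerivAt_ringInverse (𝕜 := ℂ) u
        rw [hu] at hinv
        refine (hp.mul' (hinv.comp z hq)).congr_fderiv ?_
        ext v
        simp [← hu, mul_assoc]
      have h0 := hopen.isOpen_inter_preimage_of_fderiv_eq_zero
        (fun z hz => (hd z hz).differentiableAt.differentiableWithinAt)
        (fun z hz => (hd z hz).fderiv) {N p x * Ring.inverse (N q x)}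
      have h1 := continuous_subtype_val.continuousAt.eventually (h0.mem_nhds ⟨⟨hxp, hxq⟩, rfl⟩)
      filter_upwards [h1] with y hy
      ext
      rw [Units.val_mul, Units.val_mul, hΦ p y hy.1.1, hΦinv q y hy.1.2, hΦ p x hxp, hΦinv q x hxq]
      exact hy.2)
  refine ⟨fun z => if hz : z ∈ Ω then (Ψ ⟨z, hz⟩ : B) else 0, fun z hz => ⟨?_, ?_⟩⟩
  · simp [hz]
  · have h1 := hΨ ⟨z, hz⟩ ⟨z, hz⟩ (hpV _)
    rw [nhds_subtype_eq_comap, eventually_comap] at h1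
    set p : Ω := ⟨z, hz⟩
    set c : Bˣ := Ψ p * (Φ p p)⁻¹ with hc
    have hp : HasFDerivAt (N p) _ z := (hN p z (hpV p)).2
    have h2 : HasFDerivAt (fun y => (c : B) * N p y) _ z := hp.const_mul (c : B)
    have hev : ∀ y, y ∈ Ω → y ∈ V p → (∀ b : Ω, (b : E) = y → Ψ b * (Φ p b)⁻¹ = c) →
        (if hy : y ∈ Ω then (Ψ ⟨y, hy⟩ : B) else 0) = c * N p y := by
      intro y hyΩ hyV hy
      rw [dif_pos hyΩ, ← hΦ p ⟨y, hyΩ⟩ hyV, ← Units.val_mul, ← hy ⟨y, hyΩ⟩ rfl,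
        inv_mul_cancel_right]
    have h3 := h2.congr_of_eventuallyEq (f₁ := fun z => if hz : z ∈ Ω then (Ψ ⟨z, hz⟩ : B) else 0)
      (by
        filter_upwards [h1, hΩ.mem_nhds hz, (hVo p).mem_nhds (hpV p)] with y hy hyΩ hyV
        exact hev y hyΩ hyV hy)
    refine HasFDerivAt.congr_fderiv h3 ?_
    ext v
    have := hev z hz (hpV p) fun b hb => by
      have : b = p := Subtype.ext hb
      rw [this]
    simp [this, mul_assoc]

/-! ### Locally biholomorphic maps with prescribed preSchwarzian -/

/-- A connection with an invertible parallel section is flat. -/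
theorem isFlatConnectionOn_of_isParallelAt {E B : Type*} [NormedAddCommGroup E] [NormedSpace ℂ E]
    [FiniteDimensional ℂ E] [NormedRing B] [NormedAlgebra ℂ B] [FiniteDimensional ℂ B]
    {A : E → E →L[ℂ] B} {U : Set E} (hU : IsOpen U) (hA : DifferentiableOn ℂ A U) {M : E → B}
    (hM : ∀ z ∈ U, IsUnit (M z)) (hpar : ∀ z ∈ U, IsParallelAt A M z) :
    IsFlatConnectionOn A U := by
  intro z hz v w
  have hMat : ∀ y ∈ U, HasFDerivAt M ((ContinuousLinearMap.mul ℂ B (M y)).comp (A y)) y := hpar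
  have hd : DifferentiableAt ℂ (fun y => (ContinuousLinearMap.mul ℂ B (M y)).comp (A y)) z :=
    (((ContinuousLinearMap.mul ℂ B).differentiableAt).comp z
      (hMat z hz).differentiableAt).clm_comp (hA.differentiableAt (hU.mem_nhds hz))
  have hAz := (hA.differentiableAt (hU.mem_nhds hz)).hasFDerivAt
  have happ : ∀ v w, fderiv ℂ (fun y => (ContinuousLinearMap.mul ℂ B (M y)).comp (A y)) z v w =
      M z * fderiv ℂ A z v w + M z * A z v * A z w := by
    intro v w
    have h1 := hd.hasFDerivAt.clm_apply (hasFDerivAt_const w z)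
    have h2 : HasFDerivAt (fun y => A y w) ((fderiv ℂ A z).flip w) z := by
      simpa using hAz.clm_apply (hasFDerivAt_const w z)
    have := congrArg (fun L : E →L[ℂ] B => L v) (h1.unique ((hMat z hz).mul' h2))
    simpa using this
  have hsymm := second_derivative_symmetric_of_eventually
    (eventually_of_mem (hU.mem_nhds hz) hMat) hd.hasFDerivAt v w
  rw [happ, happ, mul_assoc, mul_assoc, ← mul_add, ← mul_add] at hsymm
  exact (hM z hz).mul_left_cancel hsymm

theorem IsLocallyBiholomorphicOn.differentiableOn {n : ℕ} {f : (Fin n → ℂ) → (Fin n → ℂ)}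
    {Ω : Set (Fin n → ℂ)} (hf : IsLocallyBiholomorphicOn f Ω) : DifferentiableOn ℂ f Ω := by
  intro z hz
  obtain ⟨e, hze, -, hfe, he, -⟩ := hf z hz
  exact ((he.differentiableAt (e.open_source.mem_nhds hze)).congr_of_eventuallyEq
    (eventually_of_mem (e.open_source.mem_nhds hze) hfe)).differentiableWithinAt

theorem IsLocallyBiholomorphicOn.isInvertible_fderiv {n : ℕ} {f : (Fin n → ℂ) → (Fin n → ℂ)}
    {Ω : Set (Fin n → ℂ)} (hf : IsLocallyBiholomorphicOn f Ω) {z : Fin n → ℂ} (hz : z ∈ Ω) :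
    (fderiv ℂ f z).IsInvertible := by
  obtain ⟨e, hze, -, hfe, he, he'⟩ := hf z hz
  have hde := (he.differentiableAt (e.open_source.mem_nhds hze)).hasFDerivAt
  have hde' := (he'.differentiableAt (e.open_target.mem_nhds (e.map_source hze))).hasFDerivAt
  rw [Filter.EventuallyEq.fderiv_eq (eventually_of_mem (e.open_source.mem_nhds hze) hfe)]
  refine ContinuousLinearMap.IsInvertible.of_inverse (g := fderiv ℂ e.symm (e z)) ?_ ?_
  · have hde2 : HasFDerivAt e (fderiv ℂ e z) (e.symm (e z)) := by rwa [e.left_inv hze]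
    refine (hde2.comp (e z) hde').unique ((hasFDerivAt_id _).congr_of_eventuallyEq ?_)
    exact eventually_of_mem (e.open_target.mem_nhds (e.map_source hze)) fun y hy => e.right_inv hy
  · refine (hde'.comp z hde).unique ((hasFDerivAt_id _).congr_of_eventuallyEq ?_)
    exact eventually_of_mem (e.open_source.mem_nhds hze) fun y hy => e.left_inv hy

/-- The holomorphic inverse function theorem. -/
theorem isLocallyBiholomorphicOn_of_isInvertible {n : ℕ} {f : (Fin n → ℂ) → (Fin n → ℂ)}
    {Ω : Set (Fin n → ℂ)} (hΩ : IsOpen Ω) (hf : DifferentiableOn ℂ f Ω)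
    (hinv : ∀ z ∈ Ω, (fderiv ℂ f z).IsInvertible) : IsLocallyBiholomorphicOn f Ω := by
  intro z hz
  have hat : ∀ y ∈ Ω, HasFDerivAt f (fderiv ℂ f y) y := fun y hy =>
    (hf.differentiableAt (hΩ.mem_nhds hy)).hasFDerivAt
  obtain ⟨L, hL⟩ := hinv z hz
  have hstrict : HasStrictFDerivAt f (L : (Fin n → ℂ) →L[ℂ] (Fin n → ℂ)) z := by
    rw [hL]
    exact hasStrictFDerivAt_of_hasFDerivAt_of_continuousAt
      (eventually_of_mem (hΩ.mem_nhds hz) hat)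
      ((differentiableOn_fderiv_complex hf hΩ).differentiableAt (hΩ.mem_nhds hz)).continuousAt
  set e := (hstrict.toOpenPartialHomeomorph f).restr Ω with he
  have hcoe : ∀ y, e y = f y := fun y => rfl
  have hsrc : e.source ⊆ Ω := by
    rw [he, OpenPartialHomeomorph.restr_source, hΩ.interior_eq]
    exact inter_subset_right
  have hder : ∀ y ∈ e.source, HasFDerivAt e (fderiv ℂ f y) y := fun y hy => hat y (hsrc hy)
  refine ⟨e, ?_, hsrc, fun y _ => rfl,
    fun y hy => (hder y hy).differentiableAt.differentiableWithinAt, fun y hy => ?_⟩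
  · rw [he, OpenPartialHomeomorph.restr_source, hΩ.interior_eq]
    exact ⟨hstrict.mem_toOpenPartialHomeomorph_source, hz⟩
  · obtain ⟨L', hL'⟩ := hinv _ (hsrc (e.map_target hy))
    have h := hder _ (e.map_target hy)
    rw [← hL'] at h
    exact (e.hasFDerivAt_symm hy h).differentiableAt.differentiableWithinAt

/-- The bilinear operator on `ℂⁿ` which maps `(v, w)` to `v_j w_i e_k`. -/
noncomputable def elementaryBilin {n : ℕ} (k i j : Fin n) :
    (Fin n → ℂ) →L[ℂ] (Fin n → ℂ) →L[ℂ] (Fin n → ℂ) :=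
  (ContinuousLinearMap.proj (R := ℂ) (φ := fun _ : Fin n => ℂ) j).smulRight
    ((ContinuousLinearMap.proj (R := ℂ) (φ := fun _ : Fin n => ℂ) i).smulRight
      (Pi.single k 1 : Fin n → ℂ))

/-- The bilinear operator `A` as a connection `1`-form with values in the endomorphisms of `ℂⁿ`. -/
noncomputable def opConnection {n : ℕ} (a : Fin n → Fin n → Fin n → (Fin n → ℂ) → ℂ)
    (z : Fin n → ℂ) : (Fin n → ℂ) →L[ℂ] (Fin n → ℂ) →L[ℂ] (Fin n → ℂ) :=
  ∑ k, ∑ i, ∑ j, a k i j z • elementaryBilin k i j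

theorem opConnection_apply {n : ℕ} (a : Fin n → Fin n → Fin n → (Fin n → ℂ) → ℂ)
    (z v w : Fin n → ℂ) : opConnection a z v w = (opMatrix a z v).mulVec w := by
  ext m
  simp only [opConnection, elementaryBilin, opMatrix, sum_apply, smul_apply,
    ContinuousLinearMap.smulRight_apply, ContinuousLinearMap.proj_apply, Finset.sum_apply,
    Pi.smul_apply, Pi.single_apply, smul_eq_mul, Matrix.mulVec, dotProduct, Matrix.of_apply]
  rw [Finset.sum_eq_single m]
  · simp [Finset.sum_mul, mul_assoc]
  · intro k _ hk
    simp [hk.symm]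
  · simp

theorem opConnection_single {n : ℕ} (a : Fin n → Fin n → Fin n → (Fin n → ℂ) → ℂ)
    (z : Fin n → ℂ) (i j m : Fin n) :
    opConnection a z (Pi.single j 1) (Pi.single i 1) m = a m i j z := by
  simp [opConnection_apply, opMatrix, Matrix.mulVec_single, Pi.single_apply]

theorem differentiableAt_opConnection {n : ℕ} {a : Fin n → Fin n → Fin n → (Fin n → ℂ) → ℂ}
    {z : Fin n → ℂ} (ha : ∀ k i j, DifferentiableAt ℂ (a k i j) z) :
    DifferentiableAt ℂ (opConnection a) z := by
  refine differentiableAt_clm_of_forall_apply fun v =>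
    differentiableAt_clm_of_forall_apply fun w => ?_
  simp only [opConnection_apply]
  refine differentiableAt_pi.2 fun k => ?_
  simp only [opMatrix, Matrix.mulVec, dotProduct, Matrix.of_apply]
  exact DifferentiableAt.fun_sum fun i _ =>
    (DifferentiableAt.fun_sum fun j _ => (ha k i j).mul_const _).mul_const _

theorem fderiv_opConnection_single {n : ℕ} {a : Fin n → Fin n → Fin n → (Fin n → ℂ) → ℂ}
    {z : Fin n → ℂ} (ha : ∀ k i j, DifferentiableAt ℂ (a k i j) z) (v : Fin n → ℂ)
    (i j m : Fin n) : fderiv ℂ (opConnection a) z v (Pi.single j 1) (Pi.single i 1) m =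
      fderiv ℂ (a m i j) z v := by
  have h1 := (((differentiableAt_opConnection ha).hasFDerivAt.clm_apply
    (hasFDerivAt_const (Pi.single j 1) z)).clm_apply (hasFDerivAt_const (Pi.single i 1) z))
  have h2 := hasFDerivAt_pi'.1 h1 m
  have h3 := h2.congr_of_eventuallyEq (f₁ := a m i j)
    (Eventually.of_forall fun y => (opConnection_single a y i j m).symm)
  rw [h3.fderiv]
  simp

/-- The connection of `A` is flat if and only if `∂a^m_{ij}/∂z_l + ∑ k, a^k_{ij} a^m_{kl}` is
symmetric in `j` and `l`. -/
theorem isFlatConnectionOn_opConnection_iff {n : ℕ} {Ω : Set (Fin n → ℂ)} (hΩ : IsOpen Ω)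
    {a : Fin n → Fin n → Fin n → (Fin n → ℂ) → ℂ}
    (ha : ∀ k i j, DifferentiableOn ℂ (a k i j) Ω) :
    IsFlatConnectionOn (opConnection a) Ω ↔ ∀ z ∈ Ω, ∀ i j l m,
      partialDeriv l (a m i j) z + ∑ k, a k i j z * a m k l z =
        partialDeriv j (a m i l) z + ∑ k, a k i l z * a m k j z := by
  have key : ∀ z ∈ Ω, ∀ i j l m, ((fderiv ℂ (opConnection a) z (Pi.single l 1) (Pi.single j 1) +
      opConnection a z (Pi.single l 1) * opConnection a z (Pi.single j 1)) (Pi.single i 1)) m =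
      partialDeriv l (a m i j) z + ∑ k, a k i j z * a m k l z := by
    intro z hz i j l m
    rw [add_apply, Pi.add_apply,
      fderiv_opConnection_single fun k i j => (ha k i j).differentiableAt (hΩ.mem_nhds hz),
      show (opConnection a z (Pi.single l 1) * opConnection a z (Pi.single j 1)) (Pi.single i 1) =
        opConnection a z (Pi.single l 1) (opConnection a z (Pi.single j 1) (Pi.single i 1)) from rfl,
      opConnection_apply a z (Pi.single l 1)]
    congr 1
    simp only [Matrix.mulVec, dotProduct, opConnection_single]
    refine Finset.sum_congr rfl fun k _ => ?_
    simp [opMatrix, Pi.single_apply, mul_comm]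
  constructor
  · intro h z hz i j l m
    rw [← key z hz, ← key z hz, h z hz]
  · intro h z hz v w
    let S : (Fin n → ℂ) →ₗ[ℂ] (Fin n → ℂ) →ₗ[ℂ] ((Fin n → ℂ) →L[ℂ] (Fin n → ℂ)) :=
      LinearMap.mk₂ ℂ (fun v w => fderiv ℂ (opConnection a) z v w +
        opConnection a z v * opConnection a z w)
        (fun v v' w => by simp only [map_add, add_apply, add_mul]; abel)
        (fun c v w => by simp only [map_smul, smul_apply, smul_add]; rfl)
        (fun v w w' => by simp only [map_add, mul_add]; abel)
        (fun c v w => by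
          simp only [map_smul, smul_add]
          congr 1
          ext x : 1
          exact map_smul (opConnection a z v) c (opConnection a z w x))
    have hS : S = S.flip := by
      refine LinearMap.ext_basis (Pi.basisFun ℂ (Fin n)) (Pi.basisFun ℂ (Fin n)) fun l j => ?_
      rw [LinearMap.flip_apply]
      refine ContinuousLinearMap.coe_injective ((Pi.basisFun ℂ (Fin n)).ext fun i => ?_)
      ext m
      have h1 := key z hz i j l m
      have h2 := key z hz i l j m
      simp only [Pi.basisFun_apply]
      exact h1.trans ((h z hz i j l m).trans h2.symm)
    exact congrArg (fun T : (Fin n → ℂ) →ₗ[ℂ] (Fin n → ℂ) →ₗ[ℂ]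
      ((Fin n → ℂ) →L[ℂ] (Fin n → ℂ)) => T v w) hS

/-- There is a locally biholomorphic map with preSchwarzian `A` if and only if `A` is symmetric and
its connection is flat: the differential of such a map is a parallel section, and conversely an
invertible parallel section is a closed form by the symmetry of `A`. -/
theorem exists_preSchwarzian_eq_iff {n : ℕ} {Ω : Set (Fin n → ℂ)} (hΩ : IsOpen Ω)
    [SimplyConnectedSpace Ω] {a : Fin n → Fin n → Fin n → (Fin n → ℂ) → ℂ}
    (ha : ∀ k i j, DifferentiableOn ℂ (a k i j) Ω) :
    (∃ f : (Fin n → ℂ) → (Fin n → ℂ), IsLocallyBiholomorphicOn f Ω ∧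
        ∀ z ∈ Ω, ∀ v w, preSchwarzian f z v w = (opMatrix a z v).mulVec w) ↔
      (∀ z ∈ Ω, ∀ i j k, a k i j z = a k j i z) ∧ IsFlatConnectionOn (opConnection a) Ω := by
  have hA : DifferentiableOn ℂ (opConnection a) Ω := fun z hz =>
    (differentiableAt_opConnection fun k i j =>
      (ha k i j).differentiableAt (hΩ.mem_nhds hz)).differentiableWithinAt
  constructor
  · rintro ⟨f, hf, hP⟩
    have hfd := hf.differentiableOn
    have hM := differentiableOn_fderiv_complex hfd hΩ
    have hder : ∀ z ∈ Ω, ∀ v w,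
        fderiv ℂ (fderiv ℂ f) z v w = fderiv ℂ f z (opConnection a z v w) := by
      intro z hz v w
      rw [opConnection_apply, ← hP z hz, preSchwarzian,
        (hf.isInvertible_fderiv hz).self_apply_inverse]
    have hsymm : ∀ z ∈ Ω, ∀ v w, opConnection a z v w = opConnection a z w v := by
      intro z hz v w
      refine (hf.isInvertible_fderiv hz).injective ?_
      rw [← hder z hz, ← hder z hz]
      exact second_derivative_symmetric_of_eventually
        (eventually_of_mem (hΩ.mem_nhds hz) fun y hy =>
          (hfd.differentiableAt (hΩ.mem_nhds hy)).hasFDerivAt)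
        (hM.differentiableAt (hΩ.mem_nhds hz)).hasFDerivAt v w
    refine ⟨fun z hz i j k => ?_, ?_⟩
    · rw [← opConnection_single a, ← opConnection_single a, hsymm z hz]
    · refine isFlatConnectionOn_of_isParallelAt hΩ hA (M := fderiv ℂ f) (fun z hz => ?_)
        fun z hz => ?_
      · have hi := hf.isInvertible_fderiv hz
        exact ⟨⟨_, _, hi.self_comp_inverse, hi.inverse_comp_self⟩, rfl⟩
      · refine (hM.differentiableAt (hΩ.mem_nhds hz)).hasFDerivAt.congr_fderiv ?_
        ext1 v
        ext1 w
        exact hder z hz v w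
  · rintro ⟨hsymm, hflat⟩
    obtain ⟨M, hM⟩ := hflat.exists_global hΩ hA
    have hpar : ∀ z ∈ Ω, HasFDerivAt M _ z := fun z hz => (hM z hz).2
    have hder : ∀ z ∈ Ω, ∀ v w, fderiv ℂ M z v w = M z (opConnection a z v w) := by
      intro z hz v w
      rw [(hpar z hz).fderiv]
      rfl
    have hinv : ∀ z ∈ Ω, (M z).IsInvertible := by
      intro z hz
      obtain ⟨u, hu⟩ := (hM z hz).1
      rw [← hu]
      exact ContinuousLinearMap.IsInvertible.of_inverse u.mul_inv u.inv_mul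
    have hAsymm : ∀ z ∈ Ω, ∀ v w, opConnection a z v w = opConnection a z w v := by
      intro z hz v w
      ext k
      simp only [opConnection_apply, opMatrix, Matrix.mulVec, dotProduct, Matrix.of_apply,
        Finset.sum_mul]
      rw [Finset.sum_comm]
      refine Finset.sum_congr rfl fun i _ => Finset.sum_congr rfl fun j _ => ?_
      rw [hsymm z hz j i k]
      ring
    obtain ⟨f, hf⟩ := exists_primitive_of_closed hΩ
      (fun z hz => (hpar z hz).differentiableAt.differentiableWithinAt) (fun z hz v w => by
        rw [hder z hz, hder z hz, hAsymm z hz])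
    refine ⟨f, isLocallyBiholomorphicOn_of_isInvertible hΩ
      (fun z hz => (hf z hz).differentiableAt.differentiableWithinAt) (fun z hz => by
        rw [(hf z hz).fderiv]
        exact hinv z hz), fun z hz v w => ?_⟩
    have hev : fderiv ℂ f =ᶠ[𝓝 z] M :=
      eventually_of_mem (hΩ.mem_nhds hz) fun y hy => (hf y hy).fderiv
    rw [preSchwarzian, hev.fderiv_eq, hev.eq_of_nhds, hder z hz,
      (hinv z hz).inverse_apply_self, opConnection_apply]

/-! ### Calculus of partial derivatives -/

theorem partialDeriv_congr {n : ℕ} {i : Fin n} {f g : (Fin n → ℂ) → ℂ} {z : Fin n → ℂ}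
    (h : f =ᶠ[𝓝 z] g) : partialDeriv i f z = partialDeriv i g z := by
  rw [partialDeriv, partialDeriv, h.fderiv_eq]

theorem partialDeriv_add {n : ℕ} {i : Fin n} {f g : (Fin n → ℂ) → ℂ} {z : Fin n → ℂ}
    (hf : DifferentiableAt ℂ f z) (hg : DifferentiableAt ℂ g z) :
    partialDeriv i (fun x => f x + g x) z = partialDeriv i f z + partialDeriv i g z := by
  simp [partialDeriv, fderiv_fun_add hf hg]

theorem partialDeriv_sub {n : ℕ} {i : Fin n} {f g : (Fin n → ℂ) → ℂ} {z : Fin n → ℂ}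
    (hf : DifferentiableAt ℂ f z) (hg : DifferentiableAt ℂ g z) :
    partialDeriv i (fun x => f x - g x) z = partialDeriv i f z - partialDeriv i g z := by
  simp [partialDeriv, fderiv_fun_sub hf hg]

theorem partialDeriv_mul {n : ℕ} {i : Fin n} {f g : (Fin n → ℂ) → ℂ} {z : Fin n → ℂ}
    (hf : DifferentiableAt ℂ f z) (hg : DifferentiableAt ℂ g z) :
    partialDeriv i (fun x => f x * g x) z = partialDeriv i f z * g z + f z * partialDeriv i g z := by
  simp only [partialDeriv, fderiv_fun_mul hf hg, add_apply, smul_apply, smul_eq_mul]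
  ring

theorem partialDeriv_const_mul {n : ℕ} {i : Fin n} {f : (Fin n → ℂ) → ℂ} {z : Fin n → ℂ}
    (c : ℂ) (hf : DifferentiableAt ℂ f z) :
    partialDeriv i (fun x => c * f x) z = c * partialDeriv i f z := by
  simp [partialDeriv, fderiv_const_mul hf]

theorem partialDeriv_sum {n : ℕ} {ι : Type*} {s : Finset ι} {i : Fin n}
    {f : ι → (Fin n → ℂ) → ℂ} {z : Fin n → ℂ} (hf : ∀ k ∈ s, DifferentiableAt ℂ (f k) z) :
    partialDeriv i (fun x => ∑ k ∈ s, f k x) z = ∑ k ∈ s, partialDeriv i (f k) z := by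
  simp [partialDeriv, fderiv_fun_sum hf]

theorem differentiableOn_partialDeriv {n : ℕ} {Ω : Set (Fin n → ℂ)} (hΩ : IsOpen Ω)
    {f : (Fin n → ℂ) → ℂ} (hf : DifferentiableOn ℂ f Ω) (i : Fin n) :
    DifferentiableOn ℂ (partialDeriv i f) Ω :=
  (differentiableOn_fderiv_complex hf hΩ).clm_apply (differentiableOn_const _)

theorem partialDeriv_comm {n : ℕ} {Ω : Set (Fin n → ℂ)} (hΩ : IsOpen Ω)
    {f : (Fin n → ℂ) → ℂ} (hf : DifferentiableOn ℂ f Ω) {z : Fin n → ℂ} (hz : z ∈ Ω)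
    (i j : Fin n) :
    partialDeriv i (partialDeriv j f) z = partialDeriv j (partialDeriv i f) z := by
  have hd := ((differentiableOn_fderiv_complex hf hΩ).differentiableAt
    (hΩ.mem_nhds hz)).hasFDerivAt
  have happ : ∀ i j, partialDeriv i (partialDeriv j f) z =
      fderiv ℂ (fderiv ℂ f) z (Pi.single i 1) (Pi.single j 1) := by
    intro i j
    have := (hd.clm_apply (hasFDerivAt_const (Pi.single j 1) z)).fderiv
    change fderiv ℂ (fun y => fderiv ℂ f y (Pi.single j 1)) z (Pi.single i 1) = _
    rw [this]
    simp
  rw [happ, happ]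
  exact second_derivative_symmetric_of_eventually
    (eventually_of_mem (hΩ.mem_nhds hz) fun y hy =>
      (hf.differentiableAt (hΩ.mem_nhds hy)).hasFDerivAt) hd _ _

/-! ### Curvature under removal of the trace -/

/-- If `a^k_{ij} = P^k_{ij} + δ^k_i s_j + δ^k_j s_i`, the curvature of `a` agrees with the left hand
side minus the right hand side of the integrability condition for `P`, in which
`P⁰_{ij} = ∑ k, P^k_{ij} s_k + s_i s_j - ∂_i s_j`. Here `da m i j l` and `ds i j` stand for
`∂a^m_{ij}/∂z_l` and `∂s_j/∂z_i`. -/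
theorem curvature_eq_of_traceFree {n : ℕ} {a P : Fin n → Fin n → Fin n → ℂ} {s : Fin n → ℂ}
    (da : Fin n → Fin n → Fin n → Fin n → ℂ) {ds : Fin n → Fin n → ℂ}
    (ha : ∀ k i j, a k i j = P k i j +
      ((if k = i then 1 else 0) * s j + (if k = j then 1 else 0) * s i))
    (hP : ∀ k i j, P k i j = P k j i) (hds : ∀ i j, ds i j = ds j i) (i j l m : Fin n) :
    (da m i j l + ∑ k, a k i j * a m k l) - (da m i l j + ∑ k, a k i l * a m k j) =
      (da m i j l - ((if m = i then 1 else 0) * ds l j + (if m = j then 1 else 0) * ds l i) +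
        ∑ k, P k i j * P m k l +
        (if m = l then ∑ k, P k i j * s k + s i * s j - ds i j else 0)) -
      (da m i l j - ((if m = i then 1 else 0) * ds j l + (if m = l then 1 else 0) * ds j i) +
        ∑ k, P k i l * P m k j +
        (if m = j then ∑ k, P k i l * s k + s i * s l - ds i l else 0)) := by
  have expand : ∀ j l, ∑ k, a k i j * a m k l = ∑ k, P k i j * P m k l +
      s l * P m i j + s j * P m i l + s i * P m j l +
      (if m = l then 1 else 0) * (∑ k, P k i j * s k + 2 * s i * s j) +
      (if m = i then 1 else 0) * (s j * s l) + (if m = j then 1 else 0) * (s i * s l) := by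
    intro j l
    have h1 : ∀ (c : Fin n) (g : Fin n → ℂ), ∑ k, (if k = c then 1 else 0) * g k = g c := by
      intro c g; simp
    have h2 : ∑ k, P k i j * (if m = k then 1 else 0) = P m i j := by simp
    calc ∑ k, a k i j * a m k l = ∑ k, (P k i j * P m k l +
          s l * (P k i j * (if m = k then 1 else 0)) +
          (if m = l then 1 else 0) * (P k i j * s k) +
          s j * ((if k = i then 1 else 0) *
            (P m k l + (if m = k then 1 else 0) * s l + (if m = l then 1 else 0) * s k)) +
          s i * ((if k = j then 1 else 0) *
            (P m k l + (if m = k then 1 else 0) * s l + (if m = l then 1 else 0) * s k))) := by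
          refine Finset.sum_congr rfl fun k _ => ?_
          rw [ha, ha]
          ring
      _ = _ := by
          simp only [Finset.sum_add_distrib, ← Finset.mul_sum]
          rw [h2, h1 i fun k => P m k l + (if m = k then 1 else 0) * s l +
              (if m = l then 1 else 0) * s k, h1 j fun k => P m k l +
              (if m = k then 1 else 0) * s l + (if m = l then 1 else 0) * s k]
          ring
  have hite : ∀ (p : Prop) [Decidable p] (x : ℂ), (if p then x else 0) =
      (if p then 1 else 0) * x := by
    intro p _ x
    split_ifs <;> simp
  rw [expand j l, expand l j, hite (m = l) (∑ k, P k i j * s k + s i * s j - ds i j),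
    hite (m = j) (∑ k, P k i l * s k + s i * s l - ds i l), hP m j l, hds l j, hds l i, hds j i]
  ring

/-- The second family of integrability conditions follows from the first one if
`P⁰_{ij} = ∑ k, P^k_{ij} s_k + s_i s_j - ∂_i s_j` with a closed form `s`. The first derivatives
`dP m i j l`, `dP0 i j l`, `ds i j` and the second derivatives `dds l i j` stand for
`∂P^m_{ij}/∂z_l`, `∂P⁰_{ij}/∂z_l`, `∂s_j/∂z_i` and `∂²s_j/∂z_l∂z_i`. -/
theorem zero_coeff_of_deriv_coeff {n : ℕ} {P : Fin n → Fin n → Fin n → ℂ} {s : Fin n → ℂ}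
    {P0 ds : Fin n → Fin n → ℂ} {dP : Fin n → Fin n → Fin n → Fin n → ℂ}
    {dP0 dds : Fin n → Fin n → Fin n → ℂ}
    (hP0 : ∀ i j, P0 i j = ∑ k, P k i j * s k + s i * s j - ds i j)
    (hdP0 : ∀ i j l, dP0 i j l = ∑ k, (dP k i j l * s k + P k i j * ds l k) +
      (ds l i * s j + s i * ds l j) - dds l i j)
    (hds : ∀ i j, ds i j = ds j i) (hdds : ∀ i j l, dds l i j = dds j i l)
    (hderiv : ∀ i j l m, dP m i j l + ∑ k, P k i j * P m k l + (if m = l then P0 i j else 0) =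
      dP m i l j + ∑ k, P k i l * P m k j + (if m = j then P0 i l else 0)) (i j l : Fin n) :
    dP0 i j l + ∑ k, P k i j * P0 k l = dP0 i l j + ∑ k, P k i l * P0 k j := by
  have hsum : ∀ j l, ∑ m, s m * (dP m i j l + ∑ k, P k i j * P m k l +
      (if m = l then P0 i j else 0)) = ∑ m, dP m i j l * s m +
      ∑ k, P k i j * ∑ m, P m k l * s m + s l * P0 i j := by
    intro j l
    have h1 : ∑ k, P k i j * ∑ m, P m k l * s m = ∑ m, s m * ∑ k, P k i j * P m k l := by
      simp only [Finset.mul_sum]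
      rw [Finset.sum_comm]
      exact Finset.sum_congr rfl fun _ _ => Finset.sum_congr rfl fun _ _ => by ring
    simp only [mul_add, Finset.sum_add_distrib, h1]
    congr 1
    · congr 1
      exact Finset.sum_congr rfl fun _ _ => mul_comm _ _
    · simp
  have hcontr : ∀ j l, ∑ k, P k i j * P0 k l = ∑ k, P k i j * ∑ m, P m k l * s m +
      (∑ k, P k i j * s k) * s l - ∑ k, P k i j * ds l k := by
    intro j l
    simp only [Finset.sum_mul, ← Finset.sum_add_distrib, ← Finset.sum_sub_distrib]
    refine Finset.sum_congr rfl fun k _ => ?_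
    rw [hP0, hds k l]
    ring
  have key := Finset.sum_congr (s₁ := Finset.univ) rfl
    fun m (_ : m ∈ Finset.univ) => congrArg (s m * ·) (hderiv i j l m)
  rw [hsum j l, hsum l j] at key
  rw [hdP0, hdP0, hcontr j l, hcontr l j, Finset.sum_add_distrib, Finset.sum_add_distrib,
    hdds i j l]
  rw [hP0 i j, hP0 i l] at key
  rw [hds l i, hds l j, hds j i]
  linear_combination key

/-! ### The linear system satisfied by the exponential of the potential -/

/-- The trace of `A(z)(e_j, ·)` divided by `n + 1`, so that
`a^k_{ij} = P^k_{ij} + δ^k_i s_j + δ^k_j s_i` for `s = traceForm a`. -/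
noncomputable def traceForm {n : ℕ} (a : Fin n → Fin n → Fin n → (Fin n → ℂ) → ℂ) (j : Fin n)
    (z : Fin n → ℂ) : ℂ :=
  1 / ((n : ℂ) + 1) * ∑ k, a k k j z

/-- The coefficient `P⁰_{ij}` for which `exp (-φ / (n + 1))` solves the system, where
`∂φ/∂z_j = tr A(z)(e_j, ·)`. -/
noncomputable def zeroOrderCoeff {n : ℕ} (a : Fin n → Fin n → Fin n → (Fin n → ℂ) → ℂ)
    (i j : Fin n) (z : Fin n → ℂ) : ℂ :=
  ∑ k, traceFreePart a k i j z * traceForm a k z + traceForm a i z * traceForm a j z -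
    partialDeriv i (traceForm a j) z

theorem traceFreePart_eq {n : ℕ} (a : Fin n → Fin n → Fin n → (Fin n → ℂ) → ℂ) (k i j : Fin n) :
    traceFreePart a k i j = fun z => a k i j z -
      ((if k = i then 1 else 0) * traceForm a j z + (if k = j then 1 else 0) * traceForm a i z) := by
  have htr : ∀ j z, (opMatrix a z (Pi.single j 1)).trace = ∑ k, a k k j z := by
    intro j z
    simp [opMatrix, Matrix.trace, Pi.single_apply]
  funext z
  rw [traceFreePart, htr, htr, traceForm, traceForm]
  ring

section

variable {n : ℕ} {Ω : Set (Fin n → ℂ)} {a : Fin n → Fin n → Fin n → (Fin n → ℂ) → ℂ}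

theorem differentiableOn_traceForm (ha : ∀ k i j, DifferentiableOn ℂ (a k i j) Ω) (j : Fin n) :
    DifferentiableOn ℂ (traceForm a j) Ω :=
  (DifferentiableOn.fun_sum fun k _ => ha k k j).const_mul _

theorem differentiableOn_traceFreePart (ha : ∀ k i j, DifferentiableOn ℂ (a k i j) Ω)
    (k i j : Fin n) : DifferentiableOn ℂ (traceFreePart a k i j) Ω := by
  rw [traceFreePart_eq]
  exact (ha k i j).sub (((differentiableOn_traceForm ha j).const_mul _).add
    ((differentiableOn_traceForm ha i).const_mul _))

theorem differentiableOn_zeroOrderCoeff (hΩ : IsOpen Ω)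
    (ha : ∀ k i j, DifferentiableOn ℂ (a k i j) Ω) (i j : Fin n) :
    DifferentiableOn ℂ (zeroOrderCoeff a i j) Ω :=
  ((DifferentiableOn.fun_sum fun k _ => (differentiableOn_traceFreePart ha k i j).mul
      (differentiableOn_traceForm ha k)).add
    ((differentiableOn_traceForm ha i).mul (differentiableOn_traceForm ha j))).sub
    (differentiableOn_partialDeriv hΩ (differentiableOn_traceForm ha j) i)

theorem partialDeriv_traceFreePart (hΩ : IsOpen Ω) (ha : ∀ k i j, DifferentiableOn ℂ (a k i j) Ω)
    {z : Fin n → ℂ} (hz : z ∈ Ω) (l k i j : Fin n) :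
    partialDeriv l (traceFreePart a k i j) z = partialDeriv l (a k i j) z -
      ((if k = i then 1 else 0) * partialDeriv l (traceForm a j) z +
        (if k = j then 1 else 0) * partialDeriv l (traceForm a i) z) := by
  have hs : ∀ j, DifferentiableAt ℂ (traceForm a j) z := fun j =>
    (differentiableOn_traceForm ha j).differentiableAt (hΩ.mem_nhds hz)
  rw [traceFreePart_eq, partialDeriv_sub ((ha k i j).differentiableAt (hΩ.mem_nhds hz))
    (((hs j).const_mul _).fun_add ((hs i).const_mul _)),
    partialDeriv_add ((hs j).const_mul _) ((hs i).const_mul _), partialDeriv_const_mul _ (hs j),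
    partialDeriv_const_mul _ (hs i)]

theorem partialDeriv_zeroOrderCoeff (hΩ : IsOpen Ω)
    (ha : ∀ k i j, DifferentiableOn ℂ (a k i j) Ω) {z : Fin n → ℂ} (hz : z ∈ Ω) (l i j : Fin n) :
    partialDeriv l (zeroOrderCoeff a i j) z =
      ∑ k, (partialDeriv l (traceFreePart a k i j) z * traceForm a k z +
        traceFreePart a k i j z * partialDeriv l (traceForm a k) z) +
      (partialDeriv l (traceForm a i) z * traceForm a j z +
        traceForm a i z * partialDeriv l (traceForm a j) z) -
      partialDeriv l (partialDeriv i (traceForm a j)) z := by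
  have hs : ∀ j, DifferentiableAt ℂ (traceForm a j) z := fun j =>
    (differentiableOn_traceForm ha j).differentiableAt (hΩ.mem_nhds hz)
  have hP : ∀ k i j, DifferentiableAt ℂ (traceFreePart a k i j) z := fun k i j =>
    (differentiableOn_traceFreePart ha k i j).differentiableAt (hΩ.mem_nhds hz)
  have hds : DifferentiableAt ℂ (partialDeriv i (traceForm a j)) z :=
    (differentiableOn_partialDeriv hΩ (differentiableOn_traceForm ha j) i).differentiableAt
      (hΩ.mem_nhds hz)
  have hsum : DifferentiableAt ℂ (fun z => ∑ k, traceFreePart a k i j z * traceForm a k z) z :=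
    DifferentiableAt.fun_sum fun k _ => (hP k i j).mul (hs k)
  change partialDeriv l (fun z => ∑ k, traceFreePart a k i j z * traceForm a k z +
    traceForm a i z * traceForm a j z - partialDeriv i (traceForm a j) z) z = _
  rw [partialDeriv_sub (hsum.fun_add ((hs i).fun_mul (hs j))) hds,
    partialDeriv_add hsum ((hs i).fun_mul (hs j)), partialDeriv_mul (hs i) (hs j),
    partialDeriv_sum fun k _ => (hP k i j).fun_mul (hs k)]
  simp only [partialDeriv_mul (hP _ i j) (hs _)]

theorem traceFreePart_symm (hsymm : ∀ z ∈ Ω, ∀ i j k, a k i j z = a k j i z) {z : Fin n → ℂ}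
    (hz : z ∈ Ω) (k i j : Fin n) : traceFreePart a k i j z = traceFreePart a k j i z := by
  simp only [traceFreePart_eq]
  rw [hsymm z hz]
  ring

/-- With `P⁰ = zeroOrderCoeff a`, the first family of integrability conditions for the trace-free
part of `a` is the flatness of the connection of `a`. -/
theorem deriv_coeff_iff_isFlatConnectionOn (hΩ : IsOpen Ω)
    (ha : ∀ k i j, DifferentiableOn ℂ (a k i j) Ω)
    (hsymm : ∀ z ∈ Ω, ∀ i j k, a k i j z = a k j i z)
    (hclosed : ∀ z ∈ Ω, ∀ i j,
      partialDeriv i (traceForm a j) z = partialDeriv j (traceForm a i) z) :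
    (∀ z ∈ Ω, ∀ i j l m,
      partialDeriv l (traceFreePart a m i j) z +
          ∑ k, traceFreePart a k i j z * traceFreePart a m k l z +
          (if m = l then zeroOrderCoeff a i j z else 0) =
        partialDeriv j (traceFreePart a m i l) z +
          ∑ k, traceFreePart a k i l z * traceFreePart a m k j z +
          (if m = j then zeroOrderCoeff a i l z else 0)) ↔
      IsFlatConnectionOn (opConnection a) Ω := by
  rw [isFlatConnectionOn_opConnection_iff hΩ ha]
  refine forall₂_congr fun z hz => forall₄_congr fun i j l m => ?_
  have h := curvature_eq_of_traceFree (a := fun k i j => a k i j z)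
    (P := fun k i j => traceFreePart a k i j z) (s := fun j => traceForm a j z)
    (fun m i j l => partialDeriv l (a m i j) z)
    (ds := fun i j => partialDeriv i (traceForm a j) z)
    (fun k i j => by simp only [traceFreePart_eq]; ring)
    (fun k i j => traceFreePart_symm hsymm hz k i j) (hclosed z hz) i j l m
  rw [partialDeriv_traceFreePart hΩ ha hz, partialDeriv_traceFreePart hΩ ha hz,
    ← sub_eq_zero, ← sub_eq_zero (a := partialDeriv l (a m i j) z + _), h]
  rfl

theorem traceForm_closed_of_isFlatConnectionOn (hΩ : IsOpen Ω)
    (ha : ∀ k i j, DifferentiableOn ℂ (a k i j) Ω)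
    (hflat : IsFlatConnectionOn (opConnection a) Ω) {z : Fin n → ℂ} (hz : z ∈ Ω) (i j : Fin n) :
    partialDeriv i (traceForm a j) z = partialDeriv j (traceForm a i) z := by
  have hd : ∀ k i j, DifferentiableAt ℂ (a k i j) z := fun k i j =>
    (ha k i j).differentiableAt (hΩ.mem_nhds hz)
  have hder : ∀ i j, partialDeriv i (traceForm a j) z =
      1 / ((n : ℂ) + 1) * ∑ k, partialDeriv i (a k k j) z := by
    intro i j
    change partialDeriv i (fun z => 1 / ((n : ℂ) + 1) * ∑ k, a k k j z) z = _
    rw [partialDeriv_const_mul _ (DifferentiableAt.fun_sum fun k _ => hd k k j),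
      partialDeriv_sum fun k _ => hd k k j]
  have h := Finset.sum_congr (s₁ := Finset.univ) rfl fun m (_ : m ∈ Finset.univ) =>
    (isFlatConnectionOn_opConnection_iff hΩ ha).1 hflat z hz m j i m
  -- the quadratic terms have trace `tr (A_i A_j) = tr (A_j A_i)`
  have hquad : ∑ m, ∑ k, a k m j z * a m k i z = ∑ m, ∑ k, a k m i z * a m k j z := by
    rw [Finset.sum_comm]
    exact Finset.sum_congr rfl fun _ _ => Finset.sum_congr rfl fun _ _ => mul_comm _ _
  rw [Finset.sum_add_distrib, Finset.sum_add_distrib, hquad] at h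
  rw [hder, hder, add_right_cancel h]

theorem isIntegrableSystem_of_isFlatConnectionOn (hΩ : IsOpen Ω)
    (ha : ∀ k i j, DifferentiableOn ℂ (a k i j) Ω)
    (hsymm : ∀ z ∈ Ω, ∀ i j k, a k i j z = a k j i z)
    (hflat : IsFlatConnectionOn (opConnection a) Ω) :
    IsIntegrableSystem (traceFreePart a) (zeroOrderCoeff a) Ω := by
  have hclosed : ∀ z ∈ Ω, ∀ i j,
      partialDeriv i (traceForm a j) z = partialDeriv j (traceForm a i) z := fun z hz =>
    traceForm_closed_of_isFlatConnectionOn hΩ ha hflat hz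
  have hderiv := (deriv_coeff_iff_isFlatConnectionOn hΩ ha hsymm hclosed).2 hflat
  refine ⟨fun z hz k i j => traceFreePart_symm hsymm hz k i j, fun z hz i j => ?_, hderiv,
    fun z hz => ?_⟩
  · rw [zeroOrderCoeff, zeroOrderCoeff, hclosed z hz i j, mul_comm (traceForm a i z)]
    simp only [traceFreePart_symm hsymm hz _ i j]
  · refine zero_coeff_of_deriv_coeff (s := fun j => traceForm a j z)
      (P := fun k i j => traceFreePart a k i j z) (P0 := fun i j => zeroOrderCoeff a i j z)
      (ds := fun i j => partialDeriv i (traceForm a j) z)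
      (dP := fun m i j l => partialDeriv l (traceFreePart a m i j) z)
      (dP0 := fun i j l => partialDeriv l (zeroOrderCoeff a i j) z)
      (dds := fun l i j => partialDeriv l (partialDeriv i (traceForm a j)) z)
      (fun i j => rfl) (fun i j l => partialDeriv_zeroOrderCoeff hΩ ha hz l i j) (hclosed z hz)
      (fun i j l => ?_) (hderiv z hz)
    have hs := fun j => differentiableOn_traceForm ha j
    calc partialDeriv l (partialDeriv i (traceForm a j)) z
        = partialDeriv i (partialDeriv l (traceForm a j)) z := partialDeriv_comm hΩ (hs j) hz l i
      _ = partialDeriv i (partialDeriv j (traceForm a l)) z :=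
          partialDeriv_congr (eventually_of_mem (hΩ.mem_nhds hz) fun y hy => hclosed y hy l j)
      _ = partialDeriv j (partialDeriv i (traceForm a l)) z := partialDeriv_comm hΩ (hs l) hz i j

/-- The first and second derivatives of `exp (-φ / (n + 1))`. -/
theorem partialDeriv_exp_potential (hΩ : IsOpen Ω) (ha : ∀ k i j, DifferentiableOn ℂ (a k i j) Ω)
    {φ : (Fin n → ℂ) → ℂ} (hφ : DifferentiableOn ℂ φ Ω)
    (hφa : ∀ z ∈ Ω, ∀ j, ∑ k, a k k j z = partialDeriv j φ z) :
    DifferentiableOn ℂ (fun z => Complex.exp (-(φ z) / ((n : ℂ) + 1))) Ω ∧ ∀ z ∈ Ω,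
      (∀ k, partialDeriv k (fun z => Complex.exp (-(φ z) / ((n : ℂ) + 1))) z =
        -traceForm a k z * Complex.exp (-(φ z) / ((n : ℂ) + 1))) ∧
      ∀ i j, partialDeriv i (partialDeriv j fun z => Complex.exp (-(φ z) / ((n : ℂ) + 1))) z =
        (traceForm a i z * traceForm a j z - partialDeriv i (traceForm a j) z) *
          Complex.exp (-(φ z) / ((n : ℂ) + 1)) := by
  set u : (Fin n → ℂ) → ℂ := fun z => Complex.exp (-(φ z) / ((n : ℂ) + 1)) with hu
  have hud : DifferentiableOn ℂ u Ω := by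
    simp only [hu, div_eq_mul_inv]
    exact (hφ.fun_neg.mul_const _).cexp
  have hfirst : ∀ z ∈ Ω, ∀ k, partialDeriv k u z = -traceForm a k z * u z := by
    intro z hz k
    have h1 := (hφ.differentiableAt (hΩ.mem_nhds hz)).hasFDerivAt
    have h2 := ((h1.neg.mul_const (((n : ℂ) + 1)⁻¹)).cexp)
    have h3 : HasFDerivAt u _ z := h2.congr_of_eventuallyEq
      (Eventually.of_forall fun y => by simp [hu, div_eq_mul_inv])
    rw [partialDeriv, h3.fderiv, traceForm, hφa z hz, partialDeriv]
    simp [hu, div_eq_mul_inv]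
    ring
  refine ⟨hud, fun z hz => ⟨hfirst z hz, fun i j => ?_⟩⟩
  have hs := (differentiableOn_traceForm ha j).differentiableAt (hΩ.mem_nhds hz)
  have huz := hud.differentiableAt (hΩ.mem_nhds hz)
  rw [partialDeriv_congr (g := fun y => (-1) * (traceForm a j y * u y))
    (eventually_of_mem (hΩ.mem_nhds hz) fun y hy => by simp [hfirst y hy j]),
    partialDeriv_const_mul _ (hs.fun_mul huz), partialDeriv_mul hs huz, hfirst z hz]
  change _ = _ * u z
  ring

theorem isSystemSolution_exp_potential_iff (hΩ : IsOpen Ω)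
    (ha : ∀ k i j, DifferentiableOn ℂ (a k i j) Ω)
    {φ : (Fin n → ℂ) → ℂ} (hφ : DifferentiableOn ℂ φ Ω)
    (hφa : ∀ z ∈ Ω, ∀ j, ∑ k, a k k j z = partialDeriv j φ z)
    (P0 : Fin n → Fin n → (Fin n → ℂ) → ℂ) :
    IsSystemSolution (traceFreePart a) P0 Ω
        (fun z => Complex.exp (-(φ z) / ((n : ℂ) + 1))) ↔
      ∀ z ∈ Ω, ∀ i j, P0 i j z = zeroOrderCoeff a i j z := by
  obtain ⟨hd, hpd⟩ := partialDeriv_exp_potential hΩ ha hφ hφa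
  rw [IsSystemSolution, and_iff_right hd]
  refine forall₂_congr fun z hz => forall₂_congr fun i j => ?_
  obtain ⟨h1, h2⟩ := hpd z hz
  rw [h2]
  simp only [h1]
  have hsum : ∑ k, traceFreePart a k i j z *
      (-traceForm a k z * Complex.exp (-(φ z) / ((n : ℂ) + 1))) =
      -(∑ k, traceFreePart a k i j z * traceForm a k z) *
        Complex.exp (-(φ z) / ((n : ℂ) + 1)) := by
    rw [neg_mul, Finset.sum_mul, ← Finset.sum_neg_distrib]
    exact Finset.sum_congr rfl fun _ _ => by ring
  rw [hsum, ← add_mul, mul_left_inj' (Complex.exp_ne_zero _), zeroOrderCoeff]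
  constructor <;> intro h <;> linear_combination -h

/-- A flat connection has closed trace, hence a potential on a simply connected domain. -/
theorem exists_potential_of_isFlatConnectionOn (hΩ : IsOpen Ω) [SimplyConnectedSpace Ω]
    (ha : ∀ k i j, DifferentiableOn ℂ (a k i j) Ω)
    (hflat : IsFlatConnectionOn (opConnection a) Ω) :
    ∃ φ : (Fin n → ℂ) → ℂ, DifferentiableOn ℂ φ Ω ∧
      ∀ z ∈ Ω, ∀ j, ∑ k, a k k j z = partialDeriv j φ z := by
  let ω : (Fin n → ℂ) → (Fin n → ℂ) →L[ℂ] ℂ := fun z =>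
    ∑ j, traceForm a j z • ContinuousLinearMap.proj (R := ℂ) (φ := fun _ : Fin n => ℂ) j
  have hωapp : ∀ z v, ω z v = ∑ j, traceForm a j z * v j := by
    intro z v
    simp [ω]
  have hωsingle : ∀ z j, ω z (Pi.single j 1) = traceForm a j z := by
    intro z j
    simp [hωapp, Pi.single_apply]
  have hω : DifferentiableOn ℂ ω Ω := by
    intro z hz
    refine (differentiableAt_clm_of_forall_apply fun v => ?_).differentiableWithinAt
    simp only [hωapp]
    exact DifferentiableAt.fun_sum fun j _ => ((differentiableOn_traceForm ha j).differentiableAt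
      (hΩ.mem_nhds hz)).mul_const _
  have hdω : ∀ z ∈ Ω, ∀ v w, fderiv ℂ ω z v w = ∑ j, fderiv ℂ (traceForm a j) z v * w j := by
    intro z hz v w
    have h1 := (hω.differentiableAt (hΩ.mem_nhds hz)).hasFDerivAt.clm_apply
      (hasFDerivAt_const w z)
    have h2 : HasFDerivAt (fun y => ω y w) (∑ j, w j • fderiv ℂ (traceForm a j) z) z := by
      simp only [hωapp]
      exact HasFDerivAt.fun_sum fun j _ => ((differentiableOn_traceForm ha j).differentiableAt
        (hΩ.mem_nhds hz)).hasFDerivAt.mul_const (w j)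
    have := congrArg (fun L : (Fin n → ℂ) →L[ℂ] ℂ => L v) (h1.unique h2)
    simpa [mul_comm] using this
  have hlin : ∀ (L : (Fin n → ℂ) →L[ℂ] ℂ) v, L v = ∑ i, v i * L (Pi.single i 1) := by
    intro L v
    conv_lhs => rw [pi_eq_sum_univ' v]
    simp [map_sum]
  obtain ⟨ψ, hψ⟩ := exists_primitive_of_closed hΩ hω fun z hz v w => by
    rw [hdω z hz, hdω z hz]
    simp only [hlin (fderiv ℂ (traceForm a _) z) v, hlin (fderiv ℂ (traceForm a _) z) w,
      Finset.sum_mul]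
    rw [Finset.sum_comm]
    refine Finset.sum_congr rfl fun i _ => Finset.sum_congr rfl fun j _ => ?_
    have h := traceForm_closed_of_isFlatConnectionOn hΩ ha hflat hz i j
    simp only [partialDeriv] at h
    rw [h]
    ring
  have hn : (n : ℂ) + 1 ≠ 0 := Nat.cast_add_one_ne_zero n
  refine ⟨fun z => ((n : ℂ) + 1) * ψ z,
    fun z hz => ((hψ z hz).differentiableAt.const_mul _).differentiableWithinAt, fun z hz j => ?_⟩
  rw [partialDeriv_const_mul _ (hψ z hz).differentiableAt, partialDeriv, (hψ z hz).fderiv,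
    hωsingle, traceForm]
  field_simp

end

end

theorem theorem3p4 {n : ℕ} {Ω : Set (Fin n → ℂ)} (hΩ : IsOpen Ω) (hsc : SimplyConnectedSpace Ω)
    (a : Fin n → Fin n → Fin n → (Fin n → ℂ) → ℂ)
    (ha : ∀ k i j, DifferentiableOn ℂ (a k i j) Ω) :
    (∃ f : (Fin n → ℂ) → (Fin n → ℂ), IsLocallyBiholomorphicOn f Ω ∧
        ∀ z ∈ Ω, ∀ v w, preSchwarzian f z v w = (opMatrix a z v).mulVec w) ↔
      ((∀ z ∈ Ω, ∀ i j k, a k i j z = a k j i z) ∧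
        ∃ φ : (Fin n → ℂ) → ℂ, DifferentiableOn ℂ φ Ω ∧
          (∀ z ∈ Ω, ∀ j, ∑ k, a k k j z = partialDeriv j φ z) ∧
          ∃ P0 : Fin n → Fin n → (Fin n → ℂ) → ℂ,
            (∀ i j, DifferentiableOn ℂ (P0 i j) Ω) ∧
            IsIntegrableSystem (traceFreePart a) P0 Ω ∧
            IsSystemSolution (traceFreePart a) P0 Ω
              (fun z => Complex.exp (-(φ z) / ((n : ℂ) + 1)))) := by
  rw [exists_preSchwarzian_eq_iff hΩ ha]
  constructor
  · rintro ⟨hsymm, hflat⟩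
    obtain ⟨φ, hφ, hφa⟩ := exists_potential_of_isFlatConnectionOn hΩ ha hflat
    exact ⟨hsymm, φ, hφ, hφa, zeroOrderCoeff a, differentiableOn_zeroOrderCoeff hΩ ha,
      isIntegrableSystem_of_isFlatConnectionOn hΩ ha hsymm hflat,
      (isSystemSolution_exp_potential_iff hΩ ha hφ hφa _).2 fun _ _ _ _ => rfl⟩
  · rintro ⟨hsymm, φ, hφ, hφa, P0, -, hint, hsol⟩
    have hP0 := (isSystemSolution_exp_potential_iff hΩ ha hφ hφa P0).1 hsol
    have hs : ∀ z ∈ Ω, ∀ j, traceForm a j z = 1 / ((n : ℂ) + 1) * partialDeriv j φ z :=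
      fun z hz j => by rw [traceForm, hφa z hz]
    have hclosed : ∀ z ∈ Ω, ∀ i j,
        partialDeriv i (traceForm a j) z = partialDeriv j (traceForm a i) z := by
      have hder : ∀ z ∈ Ω, ∀ i j, partialDeriv i (traceForm a j) z =
          1 / ((n : ℂ) + 1) * partialDeriv i (partialDeriv j φ) z := fun z hz i j => by
        rw [partialDeriv_congr (Filter.eventually_of_mem (hΩ.mem_nhds hz) fun y hy => hs y hy j),
          partialDeriv_const_mul _ ((differentiableOn_partialDeriv hΩ hφ j).differentiableAt
            (hΩ.mem_nhds hz))]
      intro z hz i j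
      rw [hder z hz, hder z hz, partialDeriv_comm hΩ hφ hz]
    refine ⟨hsymm, (deriv_coeff_iff_isFlatConnectionOn hΩ ha hsymm hclosed).1
      fun z hz i j l m => ?_⟩
    rw [← hP0 z hz, ← hP0 z hz]
    exact hint.deriv_coeff z hz i j l m
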